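/- **The channel.** Three users $1,2,3$ communicate only through a relay. Let $h_1,h_2,h_3\in\mathbb{R}$ with $h_1^2\ge h_2^2\ge h_3^2$. For all distinct $j,k\in\{1,2,3\}$, user $j$ has a message $m_{jk}\in\{1,\dots,2^{nR_{jk}}\}$ for user $k$ (a set of $\lfloor 2^{nR_{jk}}\rfloor$ elements), where $R_{jk}\ge 0$; the six messages are independent and uniformly distributed. At time $i=1,\dots,n$ the relay receives $Y_{ri}=h_1X_{1i}+h_2X_{2i}+h_3X_{3i}+Z_{ri}$ and user $j$ receives $Y_{ji}=h_jX_{ri}+Z_{ji}$, where all the noises $Z_{ri},Z_{ji}$ are independent standard Gaussian variables, independent of the messages. In the general Y-channel user $j$ sends $X_{ji}=f_{j,i}\big((m_{jk})_{k\ne j},Y_{j1},\dots,Y_{j,i-1}\big)$ and the relay sends $X_{ri}=f_{r,i}(Y_{r1},\dots,Y_{r,i-1})$, subject to $\frac1n\sum_{i=1}^n\mathbb{E}[X_{ji}^2]\le P$ for each $j$ and $\frac1n\sum_{i=1}^n\mathbb{E}[X_{ri}^2]\le P_r$. User $j$ decodes the messages $(m_{kj})_{k\neq j}$ from $Y_{j1},\dots,Y_{jn}$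 and its own messages; an error occurs if at least one user decodes wrongly. A rate tuple $(R_{jk})\in\mathbb{R}_+^6$ is achievable if there is a sequence of such codes, one for each $n$, whose average error probability tends to $0$ as $n\to\infty$. The sum-capacity $C_g$ is the supremum of $\sum_{j\ne k}R_{jk}$ over all achievable rate tuples. **Theorem.** Write $C(x)=\frac12\log_2(1+x)$. For the general Y-channel with $P=P_r\ge 0$, $$C_g\;\le\;\overline{C}_{\Sigma g}(P):=C\big(h_2^2P+h_3^2P\big)+C\big(\min\{h_1^2P+h_3^2P,\;(|h_2|+|h_3|)^2P\}\big).$$ Moreover, if $h_2\neq 0$, this bound has pre-log $1$, that is, for fixed $h_1,h_2,h_3$, $\overline{C}_{\Sigma g}(P)=\log_2 P+o(\log_2 P)$ as $P\to\infty$. -/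

import Mathlib

open MeasureTheory ProbabilityTheory Filter
open scoped ENNReal Topology

namespace YChannel

/-- The three users; users 1, 2, 3 are `0`, `1`, `2`. -/
abbrev User : Type := Fin 3

/-- The nodes of the network: `none` is the relay, `some j` is user `j`. -/
abbrev Node : Type := Option User

/-- The users other than `j`. -/
abbrev Others (j : User) : Type := {k : User // k ≠ j}

/-- A rate tuple: `R j k` is the rate `R_{jk}` of the message from user `j` to user `k ≠ j`. -/
abbrev RateTuple : Type := (j : User) → Others j → ℝ

/-- The sum-rate, the sum of all six rates. -/
def sumRate (R : RateTuple) : ℝ := ∑ j, ∑ k : Others j, R j k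

/-- The message set `{1, …, 2 ^ (n r)}` of a message of rate `r` (bits per channel use) at
blocklength `n`, i.e. a set with `⌊2 ^ (n r)⌋` elements. -/
abbrev MessageSet (n : ℕ) (r : ℝ) : Type := Fin ⌊(2 : ℝ) ^ ((n : ℝ) * r)⌋₊

/-- The two messages `(m_{jk}, m_{jl})` that user `j` wants to send. -/
abbrev OwnMessages (n : ℕ) (R : RateTuple) (j : User) : Type :=
  (k : Others j) → MessageSet n (R j k)

/-- The vector of all six messages. -/
abbrev Messages (n : ℕ) (R : RateTuple) : Type := (j : User) → OwnMessages n R j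

/-- The pairs `(m_{kj}, m_{lj})` of messages that are intended for user `j`. -/
abbrev WantedMessages (n : ℕ) (R : RateTuple) (j : User) : Type :=
  (k : Others j) → MessageSet n (R k ⟨j, k.2.symm⟩)

/-- The messages intended for user `j`, extracted from the vector of all messages. -/
def wanted {n : ℕ} {R : RateTuple} (m : Messages n R) (j : User) : WantedMessages n R j :=
  fun k => m k ⟨j, k.2.symm⟩

/-- Realizations of the noise: `z i v` is the noise at node `v` at time `i`. -/
abbrev Noise (n : ℕ) : Type := Fin n → Node → ℝ

/-- A code of blocklength `n` and rate tuple `R` for the general Y-channel. The symbol of a user at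
time `i` depends on its own messages and on the symbols that it received before time `i`, the
symbol of the relay at time `i` depends on the symbols that it received before time `i`, and a
user decodes from all its received symbols and its own messages. -/
structure Code (n : ℕ) (R : RateTuple) where
  /-- the encoders `f_j` -/
  enc : (j : User) → (i : Fin n) → OwnMessages n R j → (Fin i → ℝ) → ℝ
  measurable_enc : ∀ j i w, Measurable (enc j i w)
  /-- the relay encoder `f_r` -/
  relayEnc : (i : Fin n) → (Fin i → ℝ) → ℝ
  measurable_relayEnc : ∀ i, Measurable (relayEnc i)
  /-- the decoders `g_j` -/
  dec : (j : User) → (Fin n → ℝ) → OwnMessages n R j → WantedMessages n R j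
  measurable_dec : ∀ j w, Measurable fun y => dec j y w

/-- The joint law of messages and noise: the messages are uniform (hence independent of one
another), the noises are i.i.d. standard Gaussian over all times and nodes, and messages and
noises are independent. -/
noncomputable def law (n : ℕ) (R : RateTuple) : Measure (Messages n R × Noise n) :=
  (uniformOn Set.univ).prod (Measure.pi fun _ => Measure.pi fun _ => gaussianReal 0 1)

namespace Code

variable {n : ℕ} {R : RateTuple}

/-- `c.received h m z i v` is the symbol received by node `v` at time `i`, when the code `c` is
used over the channel with coefficients `h`, messages `m` and noise `z`:
`y_{ri} = h_1 x_{1i} + h_2 x_{2i} + h_3 x_{3i} + z_{ri}` at the relay, where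
`x_{ji} = f_j (m_{jk}, m_{jl}, y_j^{i-1})`, and `y_{ji} = h_j x_{ri} + z_{ji}` at user `j`, where
`x_{ri} = f_r (y_r^{i-1})`. -/
noncomputable def received (c : Code n R) (h : User → ℝ) (m : Messages n R) (z : Noise n)
    (i : Fin n) : Node → ℝ
  | none =>
      (∑ j : User, h j *
        c.enc j i (m j) (fun s : Fin i => c.received h m z ⟨s, s.2.trans i.2⟩ (some j)))
      + z i none
  | some j =>
      h j * c.relayEnc i (fun s : Fin i => c.received h m z ⟨s, s.2.trans i.2⟩ none)
      + z i (some j)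
termination_by i.val
decreasing_by all_goals exact s.2

/-- The symbol `x_{ji}` sent by user `j` at time `i`. -/
noncomputable def sent (c : Code n R) (h : User → ℝ) (m : Messages n R) (z : Noise n)
    (j : User) (i : Fin n) : ℝ :=
  c.enc j i (m j) (fun s : Fin i => c.received h m z ⟨s, s.2.trans i.2⟩ (some j))

/-- The symbol `x_{ri}` sent by the relay at time `i`. -/
noncomputable def relaySent (c : Code n R) (h : User → ℝ) (m : Messages n R) (z : Noise n)
    (i : Fin n) : ℝ :=
  c.relayEnc i (fun s : Fin i => c.received h m z ⟨s, s.2.trans i.2⟩ none)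

/-- The average power constraints `(1/n) ∑ E[X_{ji}²] ≤ P` at the users and
`(1/n) ∑ E[X_{ri}²] ≤ P_r` at the relay. Expectations are taken in `[0, ∞]`. -/
def MeetsPower (c : Code n R) (h : User → ℝ) (P Pr : ℝ) : Prop :=
  (∀ j : User, (∑ i : Fin n, ∫⁻ ω, ENNReal.ofReal (c.sent h ω.1 ω.2 j i ^ 2) ∂law n R) / n
      ≤ ENNReal.ofReal P) ∧
    (∑ i : Fin n, ∫⁻ ω, ENNReal.ofReal (c.relaySent h ω.1 ω.2 i ^ 2) ∂law n R) / n
      ≤ ENNReal.ofReal Pr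

/-- The average error probability: the probability that some user decodes wrongly. -/
noncomputable def errorProb (c : Code n R) (h : User → ℝ) : ℝ≥0∞ :=
  law n R {ω | ∃ j : User,
    c.dec j (fun i => c.received h ω.1 ω.2 i (some j)) (ω.1 j) ≠ wanted ω.1 j}

end Code

/-- A tuple of nonnegative rates is achievable if there is a sequence of codes that satisfy the
power constraints and whose average error probability tends to zero. -/
def IsAchievable (h : User → ℝ) (P Pr : ℝ) (R : RateTuple) : Prop :=
  (∀ j k, 0 ≤ R j k) ∧
    ∃ c : (n : ℕ) → Code n R,
      (∀ n, (c n).MeetsPower h P Pr) ∧ Tendsto (fun n => (c n).errorProb h) atTop (𝓝 0)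

/-- The capacity region of the general Y-channel. -/
def capacityRegion (h : User → ℝ) (P Pr : ℝ) : Set RateTuple := {R | IsAchievable h P Pr R}

/-- The sum-capacity `C_g` of the general Y-channel: the supremum, in the extended reals, of the
sum-rates of achievable rate tuples. -/
noncomputable def sumCapacity (h : User → ℝ) (P Pr : ℝ) : EReal :=
  ⨆ R ∈ capacityRegion h P Pr, (sumRate R : EReal)

/-- `C(x) = (1/2) log (1 + x)`, with the logarithm to base 2. -/
noncomputable def gaussianCap (x : ℝ) : ℝ := 1 / 2 * Real.logb 2 (1 + x)

/-- The quantity `C(h₂² P + h₃² P) + C(min {h₁² P + h₃² P, (|h₂| + |h₃|)² P})`. -/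
noncomputable def sumBound (h₁ h₂ h₃ P : ℝ) : ℝ :=
  gaussianCap (h₂ ^ 2 * P + h₃ ^ 2 * P) +
    gaussianCap (min (h₁ ^ 2 * P + h₃ ^ 2 * P) ((|h₂| + |h₃|) ^ 2 * P))

end YChannel

namespace YChannel

open scoped NNReal

/-! ### Product measures with densities -/

/-! The six rates split into two triples `R_{ba} + R_{ca} + R_{cb}`, each bounded by a genie
argument. Let user `a` know its own messages and `m_{bc}`, and be given what `b` receives. It
decodes `m_{ba}` and `m_{ca}`, thereby knows all messages of `b`, and can imitate `b` to decode
`m_{cb}` (`Code.messages_eq_of_received_eq`). So the observation must resolve the remaining three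
messages.

On the downlink the observation is the pair `(y_a, y_b)`, the output of a Gaussian channel with the
one input `x_r`; this gives `C((h_a² + h_b²) P)`. On the uplink it is the relay's output with `h_a
x_a` removed, together with the users' noises, from which everything received can be rebuilt in
order of time; feedback may correlate `x_b` and `x_c`, which gives `C((|h_b| + |h_c|)² P)`.

Both bounds come from one converse, `log_mul_sum_measure_le`, proved without entropies. For fixed
messages the observation is a volume-preserving linear image of the noise plus a displacement
determined by past noise. This map is injective and preserves Lebesgue measure, so the law of the
observation has an explicit likelihood ratio against an independent Gaussian law `Q` with variances
`s`. The inequality `x + 1 ≤ exp x` bounds the probability of correct decoding by the `Q`-mass of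
the image of the decoding event. For messages with the same side information these images are
disjoint, so their total mass is at most the number of values of the side information. The power
constraint controls the expected log-ratio; dividing by `n` and letting `n → ∞` bounds the rates. -/

theorem lintegral_fin_nat_prod_eq_prod {n : ℕ} {E : Fin n → Type*}
    {mE : ∀ i, MeasurableSpace (E i)} {μ : (i : Fin n) → Measure (E i)} [∀ i, SigmaFinite (μ i)]
    {f : (i : Fin n) → E i → ℝ≥0∞} (hf : ∀ i, Measurable (f i)) :
    ∫⁻ x : (i : Fin n) → E i, ∏ i, f i (x i) ∂(Measure.pi μ) = ∏ i, ∫⁻ x, f i x ∂(μ i) := by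
  induction n with
  | zero => simp
  | succ n n_ih =>
    have hm : Measurable fun x : (i : Fin n) → E (Fin.succ i) => ∏ i, f (Fin.succ i) (x i) :=
      Finset.measurable_prod _ fun i _ => (hf _).comp (measurable_pi_apply i)
    rw [Fin.prod_univ_succ, ← n_ih fun i => hf i.succ,
      ← lintegral_prod_mul (hf 0).aemeasurable hm.aemeasurable,
      ← ((measurePreserving_piFinSuccAbove μ 0).symm).lintegral_comp_emb
        (MeasurableEquiv.measurableEmbedding _)]
    simp_rw [MeasurableEquiv.piFinSuccAbove_symm_apply, Fin.insertNthEquiv,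
      Fin.prod_univ_succ, Fin.insertNth_zero, Equiv.coe_fn_mk, Fin.cons_succ, Fin.cons_zero]
    rfl

theorem lintegral_fintype_prod_eq_prod {ι : Type*} [Fintype ι] {E : ι → Type*}
    {mE : ∀ i, MeasurableSpace (E i)} {μ : (i : ι) → Measure (E i)} [∀ i, SigmaFinite (μ i)]
    {f : (i : ι) → E i → ℝ≥0∞} (hf : ∀ i, Measurable (f i)) :
    ∫⁻ x : (i : ι) → E i, ∏ i, f i (x i) ∂(Measure.pi μ) = ∏ i, ∫⁻ x, f i x ∂(μ i) := by
  let e := (Fintype.equivFin ι).symm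
  rw [← (measurePreserving_piCongrLeft _ e).lintegral_comp_emb
    (MeasurableEquiv.measurableEmbedding _)]
  simp_rw [← e.prod_comp, MeasurableEquiv.coe_piCongrLeft, Equiv.piCongrLeft_apply_apply]
  exact lintegral_fin_nat_prod_eq_prod fun i => hf _

theorem pi_withDensity {ι : Type*} [Fintype ι] {E : ι → Type*}
    {mE : ∀ i, MeasurableSpace (E i)} {μ : (i : ι) → Measure (E i)} [∀ i, SigmaFinite (μ i)]
    {f : (i : ι) → E i → ℝ≥0∞} (hf : ∀ i, Measurable (f i))
    [∀ i, SigmaFinite ((μ i).withDensity (f i))] :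
    Measure.pi (fun i => (μ i).withDensity (f i)) =
      (Measure.pi μ).withDensity fun x => ∏ i, f i (x i) := by
  refine Measure.pi_eq fun s hs => ?_
  rw [withDensity_apply _ (MeasurableSet.univ_pi hs),
    ← lintegral_indicator (MeasurableSet.univ_pi hs)]
  have h : ∀ x : (i : ι) → E i, (Set.univ.pi s).indicator (fun x => ∏ i, f i (x i)) x
      = ∏ i, (s i).indicator (f i) (x i) := fun x => by
    by_cases hx : x ∈ Set.univ.pi s
    · rw [Set.indicator_of_mem hx]
      exact Finset.prod_congr rfl fun i _ => (Set.indicator_of_mem (hx i trivial) _).symm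
    · rw [Set.indicator_of_notMem hx]
      simp only [Set.mem_pi, Set.mem_univ, true_imp_iff, not_forall] at hx
      obtain ⟨i, hi⟩ := hx
      exact (Finset.prod_eq_zero (Finset.mem_univ i) (Set.indicator_of_notMem hi _)).symm
  simp_rw [h]
  rw [lintegral_fintype_prod_eq_prod fun i => (hf i).indicator (hs i)]
  exact Finset.prod_congr rfl fun i _ => by
    rw [lintegral_indicator (hs i), withDensity_apply _ (hs i)]

/-! ### Causal maps of sequences -/

/-- A map of sequences is causal if each output symbol depends only on the input symbols up to
the same time. -/
def IsCausal {E F : Type*} {n : ℕ} (Φ : (Fin n → E) → Fin n → F) : Prop :=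
  ∀ (i : Fin n) (z z' : Fin n → E), (∀ j ≤ i, z j = z' j) → Φ z i = Φ z' i

/-- A map of sequences is predictable if each output symbol depends only on the input symbols at
earlier times. -/
def IsPredictable {E F : Type*} {n : ℕ} (Φ : (Fin n → E) → Fin n → F) : Prop :=
  ∀ (i : Fin n) (z z' : Fin n → E), (∀ j < i, z j = z' j) → Φ z i = Φ z' i

/-- A triangular map with measure-preserving diagonal preserves the product measure. Fubini, peeling
off the last time, replaces a Jacobian computation, so the feedback need only be measurable. -/
theorem IsCausal.measurePreserving {E : Type*} [MeasurableSpace E] [Nonempty E] {μ : Measure E}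
    [SigmaFinite μ] {n : ℕ} {Φ : (Fin n → E) → Fin n → E} (hΦ : IsCausal Φ) (hm : Measurable Φ)
    (hs : ∀ i z, MeasurePreserving (fun v => Φ (Function.update z i v) i) μ μ) :
    MeasurePreserving Φ (Measure.pi fun _ => μ) (Measure.pi fun _ => μ) := by
  induction n with
  | zero =>
    have : Φ = id := by ext z i; exact i.elim0
    rw [this]; exact MeasurePreserving.id _
  | succ n ih =>
    let e₀ : E := Classical.arbitrary E
    let e := MeasurableEquiv.piFinSuccAbove (fun _ : Fin (n + 1) => E) (Fin.last n)
    have he : ∀ p : E × (Fin n → E), e.symm p = Fin.snoc (α := fun _ => E) p.2 p.1 := fun p => by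
      simp [e, MeasurableEquiv.piFinSuccAbove, Fin.insertNthEquiv, Fin.insertNth_last']
    have hep : MeasurePreserving e (Measure.pi fun _ => μ) (μ.prod (Measure.pi fun _ => μ)) :=
      measurePreserving_piFinSuccAbove (fun _ => μ) (Fin.last n)
    -- By causality the first `n` outputs ignore the last input, so the filler `e₀` is immaterial.
    let Φ' : (Fin n → E) → Fin n → E := fun w i =>
      Φ (Fin.snoc (α := fun _ => E) w e₀) i.castSucc
    have hsnoc : ∀ (w : Fin n → E) (v v' : E) (i : Fin n),
        Φ (Fin.snoc (α := fun _ => E) w v) i.castSucc =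
          Φ (Fin.snoc (α := fun _ => E) w v') i.castSucc := fun w v v' i => by
      refine hΦ _ _ _ fun j hj => ?_
      induction j using Fin.lastCases with
      | last => exact absurd hj (not_le.2 (Fin.castSucc_lt_last i))
      | cast j => simp
    have hmsnoc : Measurable fun p : E × (Fin n → E) => Fin.snoc (α := fun _ => E) p.2 p.1 := by
      simp_rw [← he]; exact e.symm.measurable
    have hΦ' : MeasurePreserving Φ' (Measure.pi fun _ => μ) (Measure.pi fun _ => μ) := by
      refine ih ?_ ?_ ?_
      · intro i z z' h
        refine hΦ _ _ _ fun j hj => ?_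
        induction j using Fin.lastCases with
        | last => exact absurd hj (not_le.2 (Fin.castSucc_lt_last i))
        | cast j => simpa using h j (by simpa using hj)
      · exact measurable_pi_lambda _ fun i => (measurable_pi_apply i.castSucc).comp
          (hm.comp (hmsnoc.comp (measurable_const.prodMk measurable_id)))
      · intro i z
        have := hs i.castSucc (Fin.snoc (α := fun _ => E) z e₀)
        simpa only [Φ', Fin.snoc_update] using this
    have hskew : MeasurePreserving (fun p : (Fin n → E) × E =>
        (Φ' p.1, Φ (Fin.snoc (α := fun _ => E) p.1 p.2) (Fin.last n)))
        ((Measure.pi fun _ => μ).prod μ) ((Measure.pi fun _ => μ).prod μ) := by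
      refine hΦ'.skew_product (g := fun w v => Φ (Fin.snoc (α := fun _ => E) w v) (Fin.last n))
        ?_ (Filter.Eventually.of_forall fun w => ?_)
      · exact (measurable_pi_apply _).comp (hm.comp (hmsnoc.comp measurable_swap))
      · have := (hs (Fin.last n) (Fin.snoc (α := fun _ => E) w e₀)).map_eq
        simpa only [Fin.update_snoc_last] using this
    have hcomp := hep.symm.comp ((Measure.measurePreserving_swap).comp
      (hskew.comp (Measure.measurePreserving_swap.comp hep)))
    convert hcomp using 1
    ext z i
    obtain ⟨p, rfl⟩ := e.symm.surjective z
    have hp : e (Fin.snoc (α := fun _ => E) p.2 p.1) = p := by rw [← he, e.apply_symm_apply]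
    simp only [Function.comp_apply, Prod.swap, he, hp]
    induction i using Fin.lastCases with
    | last => simp
    | cast i => simpa [Φ'] using hsnoc _ _ _ _

/-- The inputs are recovered one at a time: once the past is known, the current output determines
the current input. -/
theorem IsCausal.injective {E F : Type*} {n : ℕ} {Φ : (Fin n → E) → Fin n → F} (hΦ : IsCausal Φ)
    (hs : ∀ i z, Function.Injective fun v => Φ (Function.update z i v) i) :
    Function.Injective Φ := by
  intro z z' h
  funext i
  induction i using WellFoundedLT.induction with
  | ind i ih =>
    refine hs i z ?_
    have h₁ : Φ z' i = Φ (Function.update z i (z' i)) i := by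
      refine hΦ _ _ _ fun j hj => ?_
      rcases hj.lt_or_eq with hj | rfl
      · rw [Function.update_of_ne hj.ne, ih j hj]
      · simp
    change Φ (Function.update z i (z i)) i = Φ (Function.update z i (z' i)) i
    rw [← h₁, Function.update_eq_self, h]

/-- The map that applies `T` to each symbol and adds a displacement. -/
def shear {E : Type*} [Add E] {n : ℕ} (T : E → E) (d : (Fin n → E) → Fin n → E)
    (z : Fin n → E) (i : Fin n) : E :=
  T (z i) + d z i

section Shear

variable {E : Type*} [AddGroup E] {n : ℕ} {T : E → E} {d : (Fin n → E) → Fin n → E}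

theorem IsPredictable.isCausal_shear (hd : IsPredictable d) : IsCausal (shear T d) := by
  intro i z z' h
  rw [shear, shear, h i le_rfl, hd i z z' fun j hj => h j hj.le]

theorem IsPredictable.shear_update (hd : IsPredictable d) (i : Fin n) (z : Fin n → E) (v : E) :
    shear T d (Function.update z i v) i = T v + d z i := by
  rw [shear, Function.update_self, hd i _ z fun j hj => Function.update_of_ne hj.ne _ _]

theorem IsPredictable.injective_shear (hd : IsPredictable d) (hT : Function.Injective T) :
    Function.Injective (shear T d) := by
  refine hd.isCausal_shear.injective fun i z v v' h => ?_
  simp only [hd.shear_update] at h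
  exact hT (add_right_cancel h)

theorem measurable_shear [MeasurableSpace E] [MeasurableAdd₂ E] (hT : Measurable T)
    (hd : Measurable d) : Measurable (shear T d) :=
  measurable_pi_lambda _ fun i => (hT.comp (measurable_pi_apply i)).add
    ((measurable_pi_apply i).comp hd)

/-- With the past frozen, the current output is `T` followed by a fixed translation. -/
theorem IsPredictable.measurePreserving_shear [MeasurableSpace E] [MeasurableAdd₂ E]
    {μ : Measure E} [SigmaFinite μ] [μ.IsAddRightInvariant] (hd : IsPredictable d)
    (hdm : Measurable d) (hT : MeasurePreserving T μ μ) :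
    MeasurePreserving (shear T d) (Measure.pi fun _ => μ) (Measure.pi fun _ => μ) := by
  refine hd.isCausal_shear.measurePreserving (measurable_shear hT.measurable hdm) fun i z => ?_
  simp only [hd.shear_update]
  exact (measurePreserving_add_right μ _).comp hT

end Shear

/-! ### Gaussian noise -/

section GaussianNoise

variable {V : Type*} [Fintype V] {n : ℕ}

/-- The law of noise that is independent over times and nodes, with variance `s v` at node `v`. -/
noncomputable def gaussianNoise (n : ℕ) (s : V → ℝ≥0) : Measure (Fin n → V → ℝ) :=
  Measure.pi fun _ => Measure.pi fun v => gaussianReal 0 (s v)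

instance (s : V → ℝ≥0) : IsProbabilityMeasure (gaussianNoise n s) := by
  unfold gaussianNoise; infer_instance

theorem gaussianNoise_eq_withDensity {s : V → ℝ≥0} (hs : ∀ v, s v ≠ 0) :
    gaussianNoise n s = (volume : Measure (Fin n → V → ℝ)).withDensity
      fun z => ∏ i, ∏ v, gaussianPDF 0 (s v) (z i v) := by
  have hV : (Measure.pi fun v => gaussianReal 0 (s v)) =
      (volume : Measure (V → ℝ)).withDensity fun w => ∏ v, gaussianPDF 0 (s v) (w v) := by
    have h : ∀ v, gaussianReal 0 (s v) = volume.withDensity (gaussianPDF 0 (s v)) := fun v =>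
      gaussianReal_of_var_ne_zero 0 (hs v)
    have : ∀ v, SigmaFinite ((volume : Measure ℝ).withDensity (gaussianPDF 0 (s v))) := fun v =>
      h v ▸ inferInstance
    simp_rw [h]
    exact pi_withDensity fun v => measurable_gaussianPDF 0 (s v)
  have : SigmaFinite ((volume : Measure (V → ℝ)).withDensity
      fun w => ∏ v, gaussianPDF 0 (s v) (w v)) := hV ▸ inferInstance
  rw [gaussianNoise]
  simp_rw [hV]
  exact pi_withDensity (f := fun _ (w : V → ℝ) => ∏ v, gaussianPDF 0 (s v) (w v)) fun _ =>
    Finset.measurable_prod _ fun v _ =>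
      (measurable_gaussianPDF 0 (s v)).comp (measurable_pi_apply v)

theorem measurePreserving_eval_gaussianNoise (s : V → ℝ≥0) (i : Fin n) (v : V) :
    MeasurePreserving (fun z : Fin n → V → ℝ => z i v) (gaussianNoise n s)
      (gaussianReal 0 (s v)) :=
  (measurePreserving_eval (fun v => gaussianReal 0 (s v)) v).comp
    (measurePreserving_eval (fun _ : Fin n => Measure.pi fun v => gaussianReal 0 (s v)) i)

/-- Flipping the signs of some noise symbols does not change the law of the noise. -/
theorem measurePreserving_sign_gaussianNoise (s : V → ℝ≥0) (ε : Fin n → V → ℤˣ) :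
    MeasurePreserving (fun (z : Fin n → V → ℝ) i v => ((ε i v : ℤ) : ℝ) * z i v)
      (gaussianNoise n s) (gaussianNoise n s) := by
  refine measurePreserving_pi (f := fun i (w : V → ℝ) v => ((ε i v : ℤ) : ℝ) * w v) _ _ fun i =>
    measurePreserving_pi (f := fun v (x : ℝ) => ((ε i v : ℤ) : ℝ) * x) _ _ fun v =>
      ⟨measurable_const_mul _, ?_⟩
  rw [gaussianReal_map_const_mul]
  rcases Int.units_eq_one_or (ε i v) with h | h <;> simp [h]

theorem integrable_sq_gaussianReal (s : ℝ≥0) :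
    Integrable (fun x : ℝ => x ^ 2) (gaussianReal 0 s) :=
  (memLp_id_gaussianReal (μ := 0) (v := s) 2).integrable_sq

theorem integral_sq_gaussianReal (s : ℝ≥0) : ∫ x, x ^ 2 ∂gaussianReal 0 s = s := by
  have h := variance_fun_id_gaussianReal (μ := 0) (v := s)
  rw [variance_eq_integral (by fun_prop)] at h
  simpa using h

theorem lintegral_sq_gaussianReal (s : ℝ≥0) :
    ∫⁻ x, ENNReal.ofReal (x ^ 2) ∂gaussianReal 0 s = s := by
  rw [← ofReal_integral_eq_lintegral_ofReal (integrable_sq_gaussianReal s)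
    (Eventually.of_forall fun x => sq_nonneg x), integral_sq_gaussianReal,
    ENNReal.ofReal_coe_nnreal]

theorem lintegral_sq_gaussianNoise (s : V → ℝ≥0) (i : Fin n) (v : V) :
    ∫⁻ z, ENNReal.ofReal (z i v ^ 2) ∂gaussianNoise n s = s v := by
  rw [← lintegral_sq_gaussianReal, ← (measurePreserving_eval_gaussianNoise s i v).lintegral_comp
    (f := fun x => ENNReal.ofReal (x ^ 2)) (by fun_prop)]

theorem integrable_sq_gaussianNoise (s : V → ℝ≥0) (i : Fin n) (v : V) :
    Integrable (fun z : Fin n → V → ℝ => z i v ^ 2) (gaussianNoise n s) :=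
  ((measurePreserving_eval_gaussianNoise s i v).integrable_comp (g := fun x => x ^ 2)
    (by fun_prop)).2 (integrable_sq_gaussianReal (s v))

/-- If a measure preserving map flips the sign of `w` and leaves `d` unchanged, the second moment
of `w + d` is the sum of the second moments. -/
theorem lintegral_add_sq_of_flip {α : Type*} [MeasurableSpace α] {μ : Measure α} {f : α → α}
    (hf : MeasurePreserving f μ μ) {w d : α → ℝ} (hw : Measurable w) (hd : Measurable d)
    (hwf : ∀ x, w (f x) = -w x) (hdf : ∀ x, d (f x) = d x) :
    ∫⁻ x, ENNReal.ofReal ((w x + d x) ^ 2) ∂μ =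
      ∫⁻ x, ENNReal.ofReal (w x ^ 2) ∂μ + ∫⁻ x, ENNReal.ofReal (d x ^ 2) ∂μ := by
  have h : ∫⁻ x, ENNReal.ofReal ((-w x + d x) ^ 2) ∂μ =
      ∫⁻ x, ENNReal.ofReal ((w x + d x) ^ 2) ∂μ := by
    rw [← hf.lintegral_comp (f := fun x => ENNReal.ofReal ((w x + d x) ^ 2)) (by fun_prop)]
    simp only [hwf, hdf]
  -- Adding the integrals of `(w + d)²` and `(-w + d)²` cancels the cross term pointwise, so no
  -- integrability is needed.
  have h2 : 2 * ∫⁻ x, ENNReal.ofReal ((w x + d x) ^ 2) ∂μ =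
      2 * (∫⁻ x, ENNReal.ofReal (w x ^ 2) ∂μ + ∫⁻ x, ENNReal.ofReal (d x ^ 2) ∂μ) := by
    rw [two_mul]
    nth_rw 2 [← h]
    rw [← lintegral_add_left (by fun_prop), ← lintegral_add_left (by fun_prop),
      ← lintegral_const_mul _ (by fun_prop)]
    refine lintegral_congr fun x => ?_
    rw [← ENNReal.ofReal_add (by positivity) (by positivity),
      ← ENNReal.ofReal_add (by positivity) (by positivity),
      ← ENNReal.ofReal_ofNat, ← ENNReal.ofReal_mul (by positivity)]
    congr 1
    ring
  exact (ENNReal.mul_right_inj (by simp) (by simp)).1 h2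

/-! ### Change of measure -/

/-- The logarithm of the ratio of the density of Gaussian noise with variances `s` at `u` to the
density of standard Gaussian noise at `z`. -/
noncomputable def logRatio (s : V → ℝ≥0) (z u : Fin n → V → ℝ) : ℝ :=
  ∑ i, ∑ v, (z i v ^ 2 / 2 - u i v ^ 2 / (2 * s v) - Real.log (s v) / 2)

theorem gaussianPDF_eq_mul_exp {s : ℝ≥0} (hs : s ≠ 0) (x y : ℝ) :
    gaussianPDF 0 s y = gaussianPDF 0 1 x *
      ENNReal.ofReal (Real.exp (x ^ 2 / 2 - y ^ 2 / (2 * s) - Real.log s / 2)) := by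
  have hs' : (0 : ℝ) < s := by positivity
  rw [gaussianPDF, gaussianPDF, ← ENNReal.ofReal_mul (gaussianPDFReal_nonneg _ _ _)]
  congr 1
  have hsq : Real.exp (-(Real.log s / 2)) = (√(s : ℝ))⁻¹ := by
    rw [Real.exp_neg, Real.exp_half, Real.exp_log hs']
  have hpi : √(2 * Real.pi * s) = √(2 * Real.pi) * √(s : ℝ) := Real.sqrt_mul (by positivity) _
  rw [gaussianPDFReal, gaussianPDFReal,
    show x ^ 2 / 2 - y ^ 2 / (2 * s) - Real.log s / 2 =
      x ^ 2 / 2 + (-y ^ 2 / (2 * s) + -(Real.log s / 2)) by ring,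
    Real.exp_add, Real.exp_add, hsq, hpi]
  have hx : Real.exp (-(x - 0) ^ 2 / (2 * (1 : ℝ≥0))) * Real.exp (x ^ 2 / 2) = 1 := by
    rw [← Real.exp_add]; simp; ring
  simp only [sub_zero, NNReal.coe_one, mul_one, mul_inv] at hx ⊢
  linear_combination (-(√(2 * Real.pi))⁻¹ * Real.exp (-y ^ 2 / (2 * s)) * (√(s : ℝ))⁻¹) * hx

theorem prod_gaussianPDF_eq_mul_exp {s : V → ℝ≥0} (hs : ∀ v, s v ≠ 0) (z u : Fin n → V → ℝ) :
    ∏ i, ∏ v, gaussianPDF 0 (s v) (u i v) = (∏ i, ∏ v, gaussianPDF 0 1 (z i v)) *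
      ENNReal.ofReal (Real.exp (logRatio s z u)) := by
  rw [logRatio, Real.exp_sum, ENNReal.ofReal_prod_of_nonneg fun _ _ => by positivity,
    ← Finset.prod_mul_distrib]
  refine Finset.prod_congr rfl fun i _ => ?_
  rw [Real.exp_sum, ENNReal.ofReal_prod_of_nonneg fun _ _ => by positivity,
    ← Finset.prod_mul_distrib]
  exact Finset.prod_congr rfl fun v _ => gaussianPDF_eq_mul_exp (hs v) _ _

theorem measurable_logRatio (s : V → ℝ≥0) {Ψ : (Fin n → V → ℝ) → Fin n → V → ℝ}
    (hΨ : Measurable Ψ) : Measurable fun z => logRatio s z (Ψ z) := by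
  unfold logRatio
  fun_prop

/-- The exponential of `logRatio` is the target density at `Ψ z` over the standard density at `z`;
since `Ψ` preserves volume, no Jacobian appears. -/
theorem setLIntegral_exp_logRatio {s : V → ℝ≥0} (hs : ∀ v, s v ≠ 0)
    {Ψ : (Fin n → V → ℝ) → Fin n → V → ℝ} (hΨ : MeasurePreserving Ψ volume volume)
    (hinj : Function.Injective Ψ) {A : Set (Fin n → V → ℝ)} (hA : MeasurableSet A) :
    ∫⁻ z in A, ENNReal.ofReal (Real.exp (logRatio s z (Ψ z))) ∂gaussianNoise n (fun _ => 1) =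
      gaussianNoise n s (Ψ '' A) := by
  -- Lusin–Souslin: images of measurable sets under `Ψ` are measurable.
  have hemb : MeasurableEmbedding Ψ := hΨ.measurable.measurableEmbedding hinj
  have hpdf : ∀ s : V → ℝ≥0, Measurable fun z : Fin n → V → ℝ =>
      ∏ i, ∏ v, gaussianPDF 0 (s v) (z i v) := fun s =>
    Finset.measurable_prod _ fun i _ => Finset.measurable_prod _ fun v _ =>
      (measurable_gaussianPDF 0 (s v)).comp (by fun_prop)
  rw [gaussianNoise_eq_withDensity hs, gaussianNoise_eq_withDensity (s := fun _ => 1) (by simp),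
    withDensity_apply _ (hemb.measurableSet_image.2 hA),
    ← hΨ.setLIntegral_comp_emb hemb,
    setLIntegral_withDensity_eq_setLIntegral_mul _ (hpdf _)
      (measurable_logRatio s hΨ.measurable).exp.ennreal_ofReal hA]
  refine setLIntegral_congr_fun hA fun z _ => ?_
  exact (prod_gaussianPDF_eq_mul_exp hs _ _).symm

theorem integrable_exp_logRatio {s : V → ℝ≥0} (hs : ∀ v, s v ≠ 0)
    {Ψ : (Fin n → V → ℝ) → Fin n → V → ℝ} (hΨ : MeasurePreserving Ψ volume volume)
    (hinj : Function.Injective Ψ) :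
    Integrable (fun z => Real.exp (logRatio s z (Ψ z))) (gaussianNoise n fun _ => 1) := by
  refine ⟨(measurable_logRatio s hΨ.measurable).exp.aestronglyMeasurable, ?_⟩
  rw [hasFiniteIntegral_iff_ofReal (Eventually.of_forall fun _ => by positivity),
    ← setLIntegral_univ, setLIntegral_exp_logRatio hs hΨ hinj MeasurableSet.univ]
  exact measure_lt_top _ _

theorem setIntegral_exp_logRatio {s : V → ℝ≥0} (hs : ∀ v, s v ≠ 0)
    {Ψ : (Fin n → V → ℝ) → Fin n → V → ℝ} (hΨ : MeasurePreserving Ψ volume volume)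
    (hinj : Function.Injective Ψ) {A : Set (Fin n → V → ℝ)} (hA : MeasurableSet A) :
    ∫ z in A, Real.exp (logRatio s z (Ψ z)) ∂gaussianNoise n (fun _ => 1) =
      (gaussianNoise n s).real (Ψ '' A) := by
  rw [integral_eq_lintegral_of_nonneg_ae (Eventually.of_forall fun _ => by positivity)
    (measurable_logRatio s hΨ.measurable).exp.aestronglyMeasurable,
    setLIntegral_exp_logRatio hs hΨ hinj hA, Measure.real]

/-- A variational bound in place of Fano's inequality: it tests the likelihood ratio against the
weight `1 + N · 1_A`, coarsened to `N` on `A` and `1` off `A`. -/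
theorem log_mul_measure_add_integral_logRatio_le {s : V → ℝ≥0} (hs : ∀ v, s v ≠ 0)
    {Ψ : (Fin n → V → ℝ) → Fin n → V → ℝ} (hΨ : MeasurePreserving Ψ volume volume)
    (hinj : Function.Injective Ψ) {A : Set (Fin n → V → ℝ)} (hA : MeasurableSet A)
    (hint : Integrable (fun z => logRatio s z (Ψ z)) (gaussianNoise n fun _ => 1))
    {N : ℝ} (hN : 0 < N) :
    Real.log N * (gaussianNoise n fun _ => 1).real A +
        ∫ z, logRatio s z (Ψ z) ∂gaussianNoise n (fun _ => 1) + (1 - Real.log 2) ≤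
      (1 + N * (gaussianNoise n s).real (Ψ '' A)) / 2 := by
  have hexp := integrable_exp_logRatio hs hΨ hinj
  have hI : Integrable (A.indicator fun _ => Real.log N) (gaussianNoise n fun _ => 1) :=
    (integrable_const _).indicator hA
  have hI' : Integrable (fun z => A.indicator (fun _ => Real.log N) z + logRatio s z (Ψ z))
      (gaussianNoise n fun _ => 1) := hI.add hint
  have hpt : ∀ z, A.indicator (fun _ => Real.log N) z + logRatio s z (Ψ z) + (1 - Real.log 2) ≤
      (Real.exp (logRatio s z (Ψ z)) +
        N * A.indicator (fun z => Real.exp (logRatio s z (Ψ z))) z) / 2 := fun z => by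
    -- The shift by `log 2` normalizes that weight: averaged over the messages, its integral will be
    -- at most `2`.
    have h := Real.add_one_le_exp
      (A.indicator (fun _ => Real.log N) z + logRatio s z (Ψ z) - Real.log 2)
    refine (show _ = _ by ring).trans_le (h.trans ?_)
    rw [Real.exp_sub, Real.exp_add, Real.exp_log two_pos]
    have he := Real.exp_pos (logRatio s z (Ψ z))
    by_cases hz : z ∈ A
    · simp only [Set.indicator_of_mem hz, Real.exp_log hN]
      linarith
    · simp [Set.indicator_of_notMem hz]
  have h := integral_mono (hI'.add (integrable_const (1 - Real.log 2)))
    ((hexp.add ((hexp.indicator hA).const_mul N)).div_const 2) hpt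
  simp only [Pi.add_apply] at h
  rw [integral_add hI' (integrable_const _), integral_add hI hint, integral_div,
    integral_add hexp ((hexp.indicator hA).const_mul N), integral_const_mul,
    integral_indicator hA, integral_indicator hA, setIntegral_exp_logRatio hs hΨ hinj hA,
    ← setIntegral_univ (μ := gaussianNoise n fun _ => 1)
      (f := fun z => Real.exp (logRatio s z (Ψ z))),
    setIntegral_exp_logRatio hs hΨ hinj MeasurableSet.univ] at h
  simp only [integral_const, smul_eq_mul, probReal_univ, one_mul, measureReal_restrict_apply_univ]
    at h
  have h1 : (gaussianNoise n s).real (Ψ '' Set.univ) ≤ 1 := measureReal_le_one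
  linarith

theorem integrable_logRatio {s : V → ℝ≥0} {Ψ : (Fin n → V → ℝ) → Fin n → V → ℝ}
    (hsq : ∀ i v, Integrable (fun z => Ψ z i v ^ 2) (gaussianNoise n fun _ => 1)) :
    Integrable (fun z => logRatio s z (Ψ z)) (gaussianNoise n fun _ => 1) := by
  have hz := integrable_sq_gaussianNoise (n := n) fun _ : V => 1
  unfold logRatio
  exact integrable_finsetSum _ fun i _ => integrable_finsetSum _ fun v _ =>
    (((hz i v).div_const _).sub ((hsq i v).div_const _)).sub (integrable_const _)

theorem integral_logRatio {s : V → ℝ≥0} {Ψ : (Fin n → V → ℝ) → Fin n → V → ℝ}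
    (hsq : ∀ i v, Integrable (fun z => Ψ z i v ^ 2) (gaussianNoise n fun _ => 1)) :
    ∫ z, logRatio s z (Ψ z) ∂gaussianNoise n (fun _ => 1) =
      ∑ i, ∑ v, (1 / 2 - (∫ z, Ψ z i v ^ 2 ∂gaussianNoise n fun _ => 1) / (2 * s v)
        - Real.log (s v) / 2) := by
  have hz := integrable_sq_gaussianNoise (n := n) fun _ : V => 1
  have hz1 : ∀ i v, ∫ z : Fin n → V → ℝ, z i v ^ 2 ∂gaussianNoise n (fun _ => 1) = 1 :=
    fun i v => by
      rw [← integral_map (φ := fun z : Fin n → V → ℝ => z i v) (f := fun x => x ^ 2)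
        (measurePreserving_eval_gaussianNoise _ i v).aemeasurable
        (by fun_prop), (measurePreserving_eval_gaussianNoise _ i v).map_eq,
        integral_sq_gaussianReal, NNReal.coe_one]
  unfold logRatio
  have ht : ∀ i v, Integrable (fun z : Fin n → V → ℝ => z i v ^ 2 / 2 - Ψ z i v ^ 2 / (2 * s v)
      - Real.log (s v) / 2) (gaussianNoise n fun _ => 1) := fun i v =>
    (((hz i v).div_const _).sub ((hsq i v).div_const _)).sub (integrable_const _)
  rw [integral_finsetSum _ fun i _ => integrable_finsetSum _ fun v _ => ht i v]
  refine Finset.sum_congr rfl fun i _ => ?_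
  rw [integral_finsetSum _ fun v _ => ht i v]
  refine Finset.sum_congr rfl fun v _ => ?_
  have hzs : Integrable (fun z : Fin n → V → ℝ => z i v ^ 2 / 2 - Ψ z i v ^ 2 / (2 * s v))
      (gaussianNoise n fun _ => 1) := ((hz i v).div_const _).sub ((hsq i v).div_const _)
  rw [integral_sub hzs (integrable_const _),
    integral_sub ((hz i v).div_const _) ((hsq i v).div_const _), integral_div, integral_div, hz1,
    integral_const, probReal_univ, one_smul]

/-! ### The converse -/

/-- A converse bound: `A m` is the event that the message `m` is decoded correctly, `κ m` is the
side information at the decoder, and `Ψ m` maps the noise to the observation that, together with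
the side information, determines the message. -/
theorem log_mul_sum_measure_le {M K : Type*} [Fintype M] [Nonempty M] [Fintype K]
    {s : V → ℝ≥0} (hs : ∀ v, s v ≠ 0)
    {Ψ : M → (Fin n → V → ℝ) → Fin n → V → ℝ}
    (hΨ : ∀ m, MeasurePreserving (Ψ m) volume volume) (hinj : ∀ m, Function.Injective (Ψ m))
    {A : M → Set (Fin n → V → ℝ)} (hA : ∀ m, MeasurableSet (A m)) (κ : M → K)
    (hdec : ∀ m m' z z', κ m = κ m' → z ∈ A m → z' ∈ A m' → Ψ m z = Ψ m' z' → m = m')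
    {N : ℝ} (hN : 0 < N) (hcard : N * Fintype.card K ≤ Fintype.card M)
    (hpow : ∀ v, ∑ m, ∑ i, ∫⁻ z, ENNReal.ofReal (Ψ m z i v ^ 2) ∂gaussianNoise n (fun _ => 1) ≤
      Fintype.card M * (n * s v)) :
    Real.log N * ∑ m, (gaussianNoise n fun _ => 1).real (A m) ≤
      Fintype.card M * (Real.log 2 + n * ∑ v, Real.log (s v) / 2) := by
  classical
  have hfin : ∀ m i v, ∫⁻ z, ENNReal.ofReal (Ψ m z i v ^ 2) ∂gaussianNoise n (fun _ => 1) ≠ ∞ := by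
    intro m i v h
    have h1 := (Finset.single_le_sum (f := fun m => ∑ i, ∫⁻ z, ENNReal.ofReal (Ψ m z i v ^ 2)
      ∂gaussianNoise n (fun _ => 1)) (fun _ _ => zero_le) (Finset.mem_univ m)).trans (hpow v)
    have h2 := (Finset.single_le_sum (f := fun i => ∫⁻ z, ENNReal.ofReal (Ψ m z i v ^ 2)
      ∂gaussianNoise n (fun _ => 1)) (fun _ _ => zero_le) (Finset.mem_univ i)).trans h1
    rw [h, top_le_iff] at h2
    exact (by finiteness : (Fintype.card M * (n * s v) : ℝ≥0∞) ≠ ∞) h2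
  have hmeas : ∀ m i v, Measurable fun z => Ψ m z i v := fun m i v =>
    (measurable_pi_apply v).comp ((measurable_pi_apply i).comp (hΨ m).measurable)
  have hsq : ∀ m i v, Integrable (fun z => Ψ m z i v ^ 2) (gaussianNoise n fun _ => 1) :=
    fun m i v => ⟨((hmeas m i v).pow_const 2).aestronglyMeasurable, by
      rw [hasFiniteIntegral_iff_ofReal (Eventually.of_forall fun _ => sq_nonneg _)]
      exact (hfin m i v).lt_top⟩
  have hpow' : ∀ v, ∑ m, ∑ i, ∫ z, Ψ m z i v ^ 2 ∂gaussianNoise n (fun _ => 1) ≤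
      Fintype.card M * (n * s v) := fun v => by
    have h := ENNReal.toReal_mono (by finiteness) (hpow v)
    rw [ENNReal.toReal_sum fun m _ => by simp [hfin]] at h
    simp_rw [ENNReal.toReal_sum fun i _ => hfin _ i v] at h
    simpa [integral_eq_lintegral_of_nonneg_ae (Eventually.of_forall fun _ => sq_nonneg _)
      ((hmeas _ _ _).pow_const 2).aestronglyMeasurable] using h
  -- Within a fiber of `κ` the images are disjoint by `hdec`, so each fiber has total mass at most
  -- one.
  have hcount : ∑ m, (gaussianNoise n s).real (Ψ m '' A m) ≤ Fintype.card K := by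
    rw [← Finset.sum_fiberwise Finset.univ κ]
    refine (Finset.sum_le_sum (g := fun _ => (1 : ℝ)) fun k _ => ?_).trans (by simp)
    rw [← measureReal_biUnion_finset]
    · exact measureReal_le_one
    · intro m hm m' hm' hne
      refine Set.disjoint_left.2 ?_
      rintro _ ⟨z, hz, rfl⟩ ⟨z', hz', h⟩
      have hm := (Finset.mem_filter.1 hm).2
      have hm' := (Finset.mem_filter.1 hm').2
      exact hne (hdec m m' z z' (hm.trans hm'.symm) hz hz' h.symm)
    · exact fun m _ => ((hΨ m).measurable.measurableEmbedding (hinj m)).measurableSet_image.2 (hA m)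
  have hsum := Finset.sum_le_sum fun m (_ : m ∈ Finset.univ) =>
    log_mul_measure_add_integral_logRatio_le hs (hΨ m) (hinj m) (hA m)
      (integrable_logRatio (s := s) (hsq m)) hN
  -- The power bound makes the quadratic terms at most the `1/2` per symbol that they are compared
  -- with, leaving only the logarithms of the variances.
  have hlog : -∑ m, ∫ z, logRatio s z (Ψ m z) ∂gaussianNoise n (fun _ => 1) ≤
      Fintype.card M * (n * ∑ v, Real.log (s v) / 2) := by
    have h1 : ∀ v, ∑ m, ∑ i, -(1 / 2 - (∫ z, Ψ m z i v ^ 2 ∂gaussianNoise n fun _ => 1) / (2 * s v)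
        - Real.log (s v) / 2) ≤ Fintype.card M * (n * (Real.log (s v) / 2)) := fun v => by
      have hsv : (0 : ℝ) < s v := NNReal.coe_pos.2 (pos_iff_ne_zero.2 (hs v))
      simp_rw [Finset.sum_neg_distrib, Finset.sum_sub_distrib, ← Finset.sum_div]
      have := (div_le_div_iff_of_pos_right (by positivity : 0 < 2 * (s v : ℝ))).2 (hpow' v)
      have h3 : (Fintype.card M * (n * s v) : ℝ) / (2 * s v) = Fintype.card M * n / 2 := by
        field_simp
      rw [h3] at this
      simp only [Finset.sum_const, Finset.card_univ, Fintype.card_fin, nsmul_eq_mul]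
      linarith
    rw [← Finset.sum_neg_distrib, Finset.mul_sum, Finset.mul_sum]
    refine le_trans (le_of_eq ?_) (Finset.sum_le_sum fun v _ => h1 v)
    rw [Finset.sum_comm]
    refine Finset.sum_congr rfl fun m _ => ?_
    rw [integral_logRatio (hsq m), Finset.sum_comm, ← Finset.sum_neg_distrib]
    simp_rw [← Finset.sum_neg_distrib]
  simp only [Finset.sum_add_distrib, ← Finset.mul_sum, ← Finset.sum_div, Finset.sum_const,
    Finset.card_univ, nsmul_eq_mul] at hsum
  have := mul_le_mul_of_nonneg_left hcount hN.le
  rw [mul_add]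
  linarith

end GaussianNoise

/-! ### The channel -/

section Channel

variable {n : ℕ} {R : RateTuple}

namespace Code

theorem received_relay (c : Code n R) (h : User → ℝ) (m : Messages n R) (z : Noise n)
    (i : Fin n) : c.received h m z i none = ∑ j, h j * c.sent h m z j i + z i none := by
  rw [received]; rfl

theorem received_user (c : Code n R) (h : User → ℝ) (m : Messages n R) (z : Noise n)
    (i : Fin n) (j : User) :
    c.received h m z i (some j) = h j * c.relaySent h m z i + z i (some j) := by
  rw [received]; rfl

theorem isCausal_received (c : Code n R) (h : User → ℝ) (m : Messages n R) :
    IsCausal (c.received h m) := by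
  intro i z z' hz
  induction i using WellFoundedLT.induction with
  | ind i ih =>
    have hr : ∀ s : Fin i, c.received h m z ⟨s, s.2.trans i.2⟩ =
        c.received h m z' ⟨s, s.2.trans i.2⟩ := fun s =>
      ih _ s.2 fun j hj => hz j (hj.trans (le_of_lt s.2))
    funext v
    cases v with
    | none => simp only [received_relay, sent, hr, hz i le_rfl]
    | some j => simp only [received_user, relaySent, hr, hz i le_rfl]

theorem sent_congr (c : Code n R) (h : User → ℝ) (m : Messages n R) (j : User) (i : Fin n)
    {z z' : Noise n} (hz : ∀ k < i, z k = z' k) : c.sent h m z j i = c.sent h m z' j i := by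
  unfold sent
  congr 1
  funext s
  exact congrFun (c.isCausal_received h m _ z z' fun k hk =>
    hz k (hk.trans_lt (show (⟨s, s.2.trans i.2⟩ : Fin n) < i from s.2))) _

theorem relaySent_congr (c : Code n R) (h : User → ℝ) (m : Messages n R) (i : Fin n)
    {z z' : Noise n} (hz : ∀ k < i, z k = z' k) :
    c.relaySent h m z i = c.relaySent h m z' i := by
  unfold relaySent
  congr 1
  funext s
  exact congrFun (c.isCausal_received h m _ z z' fun k hk =>
    hz k (hk.trans_lt (show (⟨s, s.2.trans i.2⟩ : Fin n) < i from s.2))) _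

theorem measurable_received (c : Code n R) (h : User → ℝ) (m : Messages n R) (i : Fin n)
    (v : Node) : Measurable fun z => c.received h m z i v := by
  induction i using WellFoundedLT.induction generalizing v with
  | ind i ih =>
    cases v with
    | none =>
      simp only [received_relay, sent]
      refine (Finset.measurable_sum _ fun j _ => ((c.measurable_enc j i (m j)).comp
        (measurable_pi_lambda _ fun s : Fin i => ih ⟨s, s.2.trans i.2⟩ s.2 _)).const_mul _).add ?_
      fun_prop
    | some j =>
      simp only [received_user, relaySent]
      refine (((c.measurable_relayEnc i).comp
        (measurable_pi_lambda _ fun s : Fin i => ih ⟨s, s.2.trans i.2⟩ s.2 _)).const_mul _).add ?_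
      fun_prop

theorem measurable_sent (c : Code n R) (h : User → ℝ) (m : Messages n R) (j : User) (i : Fin n) :
    Measurable fun z => c.sent h m z j i :=
  (c.measurable_enc j i (m j)).comp
    (measurable_pi_lambda _ fun s : Fin i => c.measurable_received h m ⟨s, s.2.trans i.2⟩ _)

theorem measurable_relaySent (c : Code n R) (h : User → ℝ) (m : Messages n R) (i : Fin n) :
    Measurable fun z => c.relaySent h m z i :=
  (c.measurable_relayEnc i).comp
    (measurable_pi_lambda _ fun s : Fin i => c.measurable_received h m ⟨s, s.2.trans i.2⟩ _)

/-- The noise realizations for which all users decode correctly when the messages are `m`. -/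
def correct (c : Code n R) (h : User → ℝ) (m : Messages n R) : Set (Noise n) :=
  {z | ∀ j, c.dec j (fun i => c.received h m z i (some j)) (m j) = wanted m j}

theorem measurableSet_correct (c : Code n R) (h : User → ℝ) (m : Messages n R) :
    MeasurableSet (c.correct h m) := by
  rw [correct, Set.ofPred_forall]
  refine MeasurableSet.iInter fun j => ?_
  exact ((c.measurable_dec j (m j)).comp
    (measurable_pi_lambda _ fun i => c.measurable_received h m i (some j)))
    (MeasurableSet.singleton (wanted m j))

end Code

theorem user_eq_of_ne {a b c : User} (hab : a ≠ b) (hac : a ≠ c) (hbc : b ≠ c) (j : User) :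
    j = a ∨ j = b ∨ j = c := by
  revert a b c j; decide

/-- Two users that know the messages of the first of them, and the message of the second one to
the third one, determine all messages from their received symbols. -/
theorem Code.messages_eq_of_received_eq (e : Code n R) (h : User → ℝ) {a b c : User} (hab : a ≠ b)
    (hac : a ≠ c) (hbc : b ≠ c) {m m' : Messages n R} {z z' : Noise n} (hma : m a = m' a)
    (hmb : m b ⟨c, hbc.symm⟩ = m' b ⟨c, hbc.symm⟩)
    (ha : ∀ i, e.received h m z i (some a) = e.received h m' z' i (some a))
    (hb : ∀ i, e.received h m z i (some b) = e.received h m' z' i (some b))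
    (hz : z ∈ e.correct h m) (hz' : z' ∈ e.correct h m') : m = m' := by
  -- User `a` decodes first; this supplies the missing message of `b`, after which the decoder of
  -- `b` can be applied.
  have hwa : wanted m a = wanted m' a := by
    rw [← hz a, ← hz' a, hma]; simp only [ha]
  have hmb' : m b = m' b := by
    funext ⟨k, hk⟩
    rcases user_eq_of_ne hab hac hbc k with rfl | rfl | rfl
    · exact congrFun hwa ⟨b, hab.symm⟩
    · exact absurd rfl hk
    · exact hmb
  have hwb : wanted m b = wanted m' b := by
    rw [← hz b, ← hz' b, hmb']; simp only [hb]
  funext j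
  rcases user_eq_of_ne hab hac hbc j with rfl | rfl | rfl
  · exact hma
  · exact hmb'
  · funext ⟨k, hk⟩
    rcases user_eq_of_ne hab hac hbc k with rfl | rfl | rfl
    · exact congrFun hwa ⟨j, hac.symm⟩
    · exact congrFun hwb ⟨j, hbc.symm⟩
    · exact absurd rfl hk

/-! ### The joint law -/

theorem law_eq : law n R = (uniformOn Set.univ).prod (gaussianNoise n fun _ => 1) := rfl

theorem lintegral_law (f : Messages n R × Noise n → ℝ≥0∞)
    (hf : ∀ m, Measurable fun z => f (m, z)) :
    ∫⁻ ω, f ω ∂law n R = (Fintype.card (Messages n R) : ℝ≥0∞)⁻¹ *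
      ∑ m, ∫⁻ z, f (m, z) ∂gaussianNoise n (fun _ => 1) := by
  have hfm : Measurable f := measurable_from_prod_countable_right hf
  rw [law_eq, lintegral_prod _ hfm.aemeasurable, uniformOn, ProbabilityTheory.cond, lintegral_smul_measure,
    Measure.restrict_univ, lintegral_count, tsum_fintype, smul_eq_mul, Measure.count_univ,
    ENat.card_eq_coe_fintype_card]
  rfl

theorem Code.sum_measure_correct (c : Code n R) [Nonempty (Messages n R)] (h : User → ℝ) :
    ∑ m, (gaussianNoise n fun _ => 1).real (c.correct h m) =
      Fintype.card (Messages n R) * (1 - (c.errorProb h).toReal) := by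
  set E : Set (Messages n R × Noise n) := {ω | ∃ j : User,
    c.dec j (fun i => c.received h ω.1 ω.2 i (some j)) (ω.1 j) ≠ wanted ω.1 j} with hE
  have hsec : ∀ m, Prod.mk m ⁻¹' E = (c.correct h m)ᶜ := fun m => by
    ext z; simp [hE, correct]
  have hEm : MeasurableSet E := by
    have : E = ⋃ m, {m} ×ˢ (c.correct h m)ᶜ := by
      ext ⟨m, z⟩
      simp [hE, correct]
    rw [this]
    exact MeasurableSet.iUnion fun m =>
      (MeasurableSet.singleton m).prod (c.measurableSet_correct h m).compl
  have herr : c.errorProb h = (Fintype.card (Messages n R) : ℝ≥0∞)⁻¹ *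
      ∑ m, (gaussianNoise n fun _ => 1) (c.correct h m)ᶜ := by
    rw [errorProb, ← lintegral_indicator_one hEm, lintegral_law]
    · congr 1
      refine Finset.sum_congr rfl fun m _ => ?_
      rw [← hsec, ← lintegral_indicator_one (measurable_prodMk_left hEm)]
      rfl
    · exact fun m => (measurable_one.indicator hEm).comp measurable_prodMk_left
  have hcard : (Fintype.card (Messages n R) : ℝ) ≠ 0 := by
    exact_mod_cast Fintype.card_ne_zero
  have hreal : ∀ m, ((gaussianNoise n fun _ => 1) (c.correct h m)ᶜ).toReal =
      1 - (gaussianNoise n fun _ => 1).real (c.correct h m) := fun m =>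
    probReal_compl_eq_one_sub (c.measurableSet_correct h m)
  rw [herr, ENNReal.toReal_mul, ENNReal.toReal_sum fun m _ => measure_ne_top _ _]
  simp_rw [hreal]
  simp only [ENNReal.toReal_inv, ENNReal.toReal_natCast, Finset.sum_sub_distrib,
    Finset.sum_const, Finset.card_univ, nsmul_eq_mul, mul_one]
  field_simp
  ring

/-- Rewrites the power constraint, an average over messages and times, as the double sum used by the
converse. -/
theorem sum_lintegral_le_of_power [Nonempty (Messages n R)] (hn : n ≠ 0) {P : ℝ≥0}
    {x : Messages n R → Noise n → Fin n → ℝ} (hx : ∀ m i, Measurable fun z => x m z i)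
    (hP : (∑ i, ∫⁻ ω, ENNReal.ofReal (x ω.1 ω.2 i ^ 2) ∂law n R) / n ≤ P) :
    ∑ m, ∑ i, ∫⁻ z, ENNReal.ofReal (x m z i ^ 2) ∂gaussianNoise n (fun _ => 1) ≤
      Fintype.card (Messages n R) * (n * P) := by
  have hcard : (Fintype.card (Messages n R) : ℝ≥0∞) ≠ 0 := by
    exact_mod_cast Fintype.card_ne_zero
  rw [ENNReal.div_le_iff (by exact_mod_cast hn) (by finiteness)] at hP
  simp_rw [lintegral_law (fun ω => ENNReal.ofReal (x ω.1 ω.2 _ ^ 2)) fun m =>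
    ((hx m _).pow_const 2).ennreal_ofReal] at hP
  rw [← Finset.mul_sum, Finset.sum_comm] at hP
  rw [mul_comm (n : ℝ≥0∞)]
  rwa [ENNReal.inv_mul_le_iff hcard (by finiteness)] at hP

end Channel

/-! ### Second moments -/

section SecondMoments

variable {V : Type*} [Fintype V] {n : ℕ}

/-- Flipping the sign of the noise at time `i` alone negates `w` and is invisible to the predictable
term `d` at time `i`. -/
theorem lintegral_add_sq_of_predictable {w : (V → ℝ) → ℝ} (hw : Measurable w)
    (hodd : ∀ v, w (-v) = -w v) {d : (Fin n → V → ℝ) → Fin n → ℝ} (hd : IsPredictable d)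
    (hdm : ∀ i, Measurable fun z => d z i) (i : Fin n) :
    ∫⁻ z, ENNReal.ofReal ((w (z i) + d z i) ^ 2) ∂gaussianNoise n (fun _ => 1) =
      ∫⁻ z, ENNReal.ofReal (w (z i) ^ 2) ∂gaussianNoise n (fun _ => 1) +
        ∫⁻ z, ENNReal.ofReal (d z i ^ 2) ∂gaussianNoise n (fun _ => 1) := by
  refine lintegral_add_sq_of_flip (measurePreserving_sign_gaussianNoise (fun _ => 1)
    fun k _ => if k = i then -1 else 1) (hw.comp (measurable_pi_apply i)) (hdm i)
    (fun z => ?_) fun z => ?_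
  · rw [← hodd]
    congr 1
    funext v
    simp
  · refine hd _ _ _ fun j hj => ?_
    funext v
    simp [hj.ne]

theorem sum_lintegral_add_sq_le {M : Type*} [Fintype M] {w : (V → ℝ) → ℝ} (hw : Measurable w)
    (hodd : ∀ v, w (-v) = -w v) {W D : ℝ≥0∞}
    (hW : ∀ i : Fin n, ∫⁻ z, ENNReal.ofReal (w (z i) ^ 2) ∂gaussianNoise n (fun _ => 1) ≤ W)
    {d : M → (Fin n → V → ℝ) → Fin n → ℝ} (hd : ∀ m, IsPredictable (d m))
    (hdm : ∀ m i, Measurable fun z => d m z i)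
    (hD : ∑ m, ∑ i, ∫⁻ z, ENNReal.ofReal (d m z i ^ 2) ∂gaussianNoise n (fun _ => 1) ≤
      Fintype.card M * (n * D)) :
    ∑ m, ∑ i, ∫⁻ z, ENNReal.ofReal ((w (z i) + d m z i) ^ 2) ∂gaussianNoise n (fun _ => 1) ≤
      Fintype.card M * (n * (W + D)) := by
  simp_rw [lintegral_add_sq_of_predictable hw hodd (hd _) (hdm _), Finset.sum_add_distrib]
  rw [mul_add, mul_add]
  refine add_le_add ?_ hD
  refine (Finset.sum_le_sum fun m _ => Finset.sum_le_sum fun i _ => hW i).trans ?_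
  simp

theorem sum_lintegral_const_mul_sq_le {M : Type*} [Fintype M] {D : ℝ≥0}
    {x : M → (Fin n → V → ℝ) → Fin n → ℝ} (hxm : ∀ m i, Measurable fun z => x m z i)
    (hx : ∑ m, ∑ i, ∫⁻ z, ENNReal.ofReal (x m z i ^ 2) ∂gaussianNoise n (fun _ => 1) ≤
      Fintype.card M * (n * D)) (t : ℝ) :
    ∑ m, ∑ i, ∫⁻ z, ENNReal.ofReal ((t * x m z i) ^ 2) ∂gaussianNoise n (fun _ => 1) ≤
      Fintype.card M * (n * ((t ^ 2).toNNReal * D : ℝ≥0)) := by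
  simp_rw [mul_pow, ENNReal.ofReal_mul (sq_nonneg t)]
  simp_rw [lintegral_const_mul _ ((hxm _ _).pow_const 2).ennreal_ofReal, ← Finset.mul_sum]
  refine (mul_le_mul_right hx _).trans (le_of_eq ?_)
  rw [ENNReal.coe_mul, ENNReal.ofReal]
  ring

theorem add_sq_le_abs_add_abs_mul (s t x y : ℝ) :
    (s * x + t * y) ^ 2 ≤ (|s| + |t|) * (|s| * x ^ 2 + |t| * y ^ 2) := by
  rw [← sq_abs x, ← sq_abs y]
  have h : |s * x + t * y| ≤ |s| * |x| + |t| * |y| := by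
    simpa only [abs_mul] using abs_add_le (s * x) (t * y)
  have h2 := pow_le_pow_left₀ (abs_nonneg _) h 2
  rw [sq_abs] at h2
  nlinarith [mul_nonneg (mul_nonneg (abs_nonneg s) (abs_nonneg t)) (sq_nonneg (|x| - |y|))]

/-- Weighted Cauchy–Schwarz. The two signals may be correlated through feedback, hence `(|s| +
|t|)²` rather than `s² + t²`. -/
theorem sum_lintegral_add_const_mul_sq_le {M : Type*} [Fintype M] {D : ℝ≥0}
    {x y : M → (Fin n → V → ℝ) → Fin n → ℝ} (hxm : ∀ m i, Measurable fun z => x m z i)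
    (hym : ∀ m i, Measurable fun z => y m z i)
    (hx : ∑ m, ∑ i, ∫⁻ z, ENNReal.ofReal (x m z i ^ 2) ∂gaussianNoise n (fun _ => 1) ≤
      Fintype.card M * (n * D))
    (hy : ∑ m, ∑ i, ∫⁻ z, ENNReal.ofReal (y m z i ^ 2) ∂gaussianNoise n (fun _ => 1) ≤
      Fintype.card M * (n * D)) (s t : ℝ) :
    ∑ m, ∑ i, ∫⁻ z, ENNReal.ofReal ((s * x m z i + t * y m z i) ^ 2)
        ∂gaussianNoise n (fun _ => 1) ≤
      Fintype.card M * (n * (((|s| + |t|) ^ 2).toNNReal * D : ℝ≥0)) := by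
  have hpt : ∀ m i, ∫⁻ z, ENNReal.ofReal ((s * x m z i + t * y m z i) ^ 2)
        ∂gaussianNoise n (fun _ => 1) ≤
      ENNReal.ofReal (|s| + |t|) * (ENNReal.ofReal |s| *
          ∫⁻ z, ENNReal.ofReal (x m z i ^ 2) ∂gaussianNoise n (fun _ => 1) +
        ENNReal.ofReal |t| *
          ∫⁻ z, ENNReal.ofReal (y m z i ^ 2) ∂gaussianNoise n (fun _ => 1)) := fun m i => by
    have hxm := hxm m i
    have hym := hym m i
    rw [← lintegral_const_mul _ (by fun_prop), ← lintegral_const_mul _ (by fun_prop),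
      ← lintegral_add_left (by fun_prop), ← lintegral_const_mul _ (by fun_prop)]
    refine lintegral_mono fun z => ?_
    simp only
    rw [← ENNReal.ofReal_mul (by positivity), ← ENNReal.ofReal_mul (by positivity),
      ← ENNReal.ofReal_add (by positivity) (by positivity), ← ENNReal.ofReal_mul (by positivity)]
    exact ENNReal.ofReal_le_ofReal (add_sq_le_abs_add_abs_mul _ _ _ _)
  refine (Finset.sum_le_sum fun m _ => Finset.sum_le_sum fun i _ => hpt m i).trans ?_
  simp_rw [← Finset.mul_sum, Finset.sum_add_distrib, ← Finset.mul_sum]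
  refine (mul_le_mul_right (add_le_add (mul_le_mul_right hx _) (mul_le_mul_right hy _)) _).trans
    (le_of_eq ?_)
  rw [← add_mul, ← ENNReal.ofReal_add (abs_nonneg s) (abs_nonneg t), ENNReal.coe_mul,
    Real.toNNReal_pow (by positivity), ENNReal.coe_pow, ENNReal.ofReal]
  ring

end SecondMoments

/-! ### A transvection of the noise symbols -/

/-- Subtract `t` times the symbol of node `a` from the symbol of node `b`. -/
def mix {V : Type*} [DecidableEq V] (a b : V) (t : ℝ) (v : V → ℝ) : V → ℝ :=
  Function.update v b (v b - t * v a)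

theorem injective_mix {V : Type*} [DecidableEq V] {a b : V} (hab : a ≠ b) (t : ℝ) :
    Function.Injective (mix a b t) := by
  intro v v' h
  have hne : ∀ k, k ≠ b → v k = v' k := fun k hk => by
    simpa [mix, hk] using congrFun h k
  funext k
  by_cases hk : k = b
  · have := congrFun h b
    simp only [mix, Function.update_self, hne a hab] at this
    rw [hk]
    linarith
  · exact hne k hk

theorem measurePreserving_mix {V : Type*} [Fintype V] [DecidableEq V] {a b : V} (hab : a ≠ b)
    (t : ℝ) : MeasurePreserving (mix a b t) volume volume := by
  have h := Real.volume_preserving_transvectionStruct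
    (⟨b, a, hab.symm, -t⟩ : Matrix.TransvectionStruct V ℝ)
  suffices heq : mix a b t = Matrix.toLin' (Matrix.TransvectionStruct.toMatrix
      (⟨b, a, hab.symm, -t⟩ : Matrix.TransvectionStruct V ℝ)) by rw [heq]; exact h
  funext v k
  simp only [mix, Matrix.TransvectionStruct.toMatrix, Matrix.transvection, Matrix.toLin'_apply,
    Matrix.add_mulVec, Matrix.one_mulVec, Matrix.single_mulVec, Pi.add_apply]
  by_cases hk : k = b
  · subst hk; simp; ring
  · simp [hk]

/-! ### Genie-aided bounds -/

section Bounds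

variable {n : ℕ} {R : RateTuple}

theorem sum_user {M : Type*} [AddCommMonoid M] {a b c : User} (hab : a ≠ b) (hac : a ≠ c)
    (hbc : b ≠ c) (f : User → M) : ∑ j, f j = f a + f b + f c := by
  have : (Finset.univ : Finset User) = {a, b, c} := by
    ext j; simpa using user_eq_of_ne hab hac hbc j
  rw [this, Finset.sum_insert (by simp [hab, hac]), Finset.sum_pair hbc, add_assoc]

/-- The uplink bound: the user `a` is given the received symbols of the relay and the noise of
user `b`. -/
theorem Code.log_mul_le_uplink [Nonempty (Messages n R)] (hn : n ≠ 0) (e : Code n R)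
    (h : User → ℝ) {P : ℝ≥0}
    (hP : ∀ j : User, (∑ i : Fin n, ∫⁻ ω, ENNReal.ofReal (e.sent h ω.1 ω.2 j i ^ 2) ∂law n R) / n
      ≤ P) {a b c : User} (hab : a ≠ b) (hac : a ≠ c) (hbc : b ≠ c) {N : ℝ} (hN : 0 < N)
    (hcard : N * Fintype.card (OwnMessages n R a × MessageSet n (R b ⟨c, hbc.symm⟩)) ≤
      Fintype.card (Messages n R)) :
    Real.log N * (1 - (e.errorProb h).toReal) ≤
      Real.log 2 + n * (Real.log (1 + (|h b| + |h c|) ^ 2 * P) / 2) := by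
  have hMpos : (0 : ℝ) < Fintype.card (Messages n R) := by exact_mod_cast Fintype.card_pos
  let x : User → Messages n R → Noise n → Fin n → ℝ := fun j m z i => e.sent h m z j i
  have hxm : ∀ j m i, Measurable fun z => x j m z i := fun j m i => e.measurable_sent h m j i
  let δ : Messages n R → Noise n → Fin n → ℝ := fun m z i => h b * x b m z i + h c * x c m z i
  have hδm : ∀ m i, Measurable fun z => δ m z i := fun m i =>
    ((hxm b m i).const_mul _).add ((hxm c m i).const_mul _)
  have hδ : ∀ m, IsPredictable (δ m) := fun m i z z' hz => by
    simp only [δ, x, e.sent_congr h m _ i hz]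
  -- Only the relay slot is displaced, by the signals of `b` and `c`; the user slots keep the bare
  -- noise, of variance one, and cost nothing in the bound.
  let d : Messages n R → Noise n → Fin n → Node → ℝ := fun m z i =>
    Function.update 0 none (δ m z i)
  have hd : ∀ m, IsPredictable (d m) := fun m i z z' hz => by simp only [d, hδ m i z z' hz]
  have hdm : ∀ m, Measurable (d m) := fun m => measurable_pi_lambda _ fun i =>
    measurable_pi_lambda _ fun v => by
      cases v with
      | none => simpa [d] using hδm m i
      | some j => simp [d]
  let s : Node → ℝ≥0 := Function.update 1 none (1 + ((|h b| + |h c|) ^ 2).toNNReal * P)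
  have hs : ∀ v, s v ≠ 0 := fun v => by
    cases v <;> simp [s]
  have key := log_mul_sum_measure_le (n := n) hs (Ψ := fun m => shear id (d m))
    (fun m => (hd m).measurePreserving_shear (hdm m) (MeasurePreserving.id volume))
    (fun m => (hd m).injective_shear Function.injective_id)
    (A := fun m => e.correct h m) (fun m => e.measurableSet_correct h m)
    (fun m => (m a, m b ⟨c, hbc.symm⟩)) ?_ hN hcard ?_
  · rw [e.sum_measure_correct, Fintype.sum_option] at key
    have hsv : ∀ j : User, s (some j) = 1 := fun j => by simp [s]
    have hs0 : s none = 1 + ((|h b| + |h c|) ^ 2).toNNReal * P := by simp [s]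
    simp only [hsv, hs0, NNReal.coe_one, Real.log_one, zero_div, Finset.sum_const_zero, add_zero,
      NNReal.coe_add, NNReal.coe_mul, Real.coe_toNNReal _ (sq_nonneg (|h b| + |h c|))] at key
    rw [mul_left_comm] at key
    exact le_of_mul_le_mul_left key hMpos
  · intro m m' z z' hκ hz hz' hΨ
    have hma : m a = m' a := congrArg Prod.fst hκ
    have hnoise : ∀ i j, z i (some j) = z' i (some j) := fun i j => by
      simpa [shear, d] using congrFun (congrFun hΨ i) (some j)
    have hrel : ∀ i, z i none + δ m z i = z' i none + δ m' z' i := fun i => by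
      simpa [shear, d] using congrFun (congrFun hΨ i) none
    -- Induction on time: the past gives `x_a` and `x_r`, and with them the observation gives the
    -- current received symbols.
    have hrec : ∀ i v, e.received h m z i v = e.received h m' z' i v := by
      intro i
      induction i using WellFoundedLT.induction with
      | ind i ih =>
        intro v
        cases v with
        | none =>
          have hsent : e.sent h m z a i = e.sent h m' z' a i := by
            unfold sent
            rw [hma]
            congr 1
            funext s
            exact ih _ s.2 _
          have := hrel i
          simp only [δ, x] at this
          rw [received_relay, received_relay, sum_user hab hac hbc, sum_user hab hac hbc, hsent]
          linarith
        | some j =>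
          have hsent : e.relaySent h m z i = e.relaySent h m' z' i := by
            unfold relaySent
            congr 1
            funext s
            exact ih _ s.2 _
          rw [received_user, received_user, hsent, hnoise]
    exact e.messages_eq_of_received_eq h hab hac hbc hma (congrArg Prod.snd hκ)
      (fun i => hrec i _) (fun i => hrec i _) hz hz'
  · intro v
    cases v with
    | none =>
      have := sum_lintegral_add_sq_le (n := n) (w := fun v : Node → ℝ => v none) (by fun_prop)
        (fun _ => rfl) (fun i => (lintegral_sq_gaussianNoise (fun _ => 1) i none).le) hδ hδm
        (sum_lintegral_add_const_mul_sq_le (hxm b) (hxm c)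
          (sum_lintegral_le_of_power hn (hxm b) (hP b))
          (sum_lintegral_le_of_power hn (hxm c) (hP c)) (h b) (h c))
      simpa [shear, d, s] using this
    | some j =>
      simp [shear, d, s, lintegral_sq_gaussianNoise]

/-- The downlink bound: the user `a` is given the received symbols of user `b`. -/
theorem Code.log_mul_le_downlink [Nonempty (Messages n R)] (hn : n ≠ 0) (e : Code n R)
    (h : User → ℝ) {P : ℝ≥0}
    (hP : (∑ i : Fin n, ∫⁻ ω, ENNReal.ofReal (e.relaySent h ω.1 ω.2 i ^ 2) ∂law n R) / n ≤ P)
    {a b c : User} (hab : a ≠ b) (hac : a ≠ c) (hbc : b ≠ c) {N : ℝ} (hN : 0 < N)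
    (hcard : N * Fintype.card (OwnMessages n R a × MessageSet n (R b ⟨c, hbc.symm⟩)) ≤
      Fintype.card (Messages n R)) :
    Real.log N * (1 - (e.errorProb h).toReal) ≤
      Real.log 2 + n * (Real.log (1 + (h a ^ 2 + h b ^ 2) * P) / 2) := by
  have hMpos : (0 : ℝ) < Fintype.card (Messages n R) := by exact_mod_cast Fintype.card_pos
  have hab' : (some a : Node) ≠ some b := by simpa using hab
  let x : Messages n R → Noise n → Fin n → ℝ := fun m z i => e.relaySent h m z i
  have hxm : ∀ m i, Measurable fun z => x m z i := fun m i => e.measurable_relaySent h m i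
  have hx : ∀ m, IsPredictable (x m) := fun m i z z' hz => e.relaySent_congr h m i hz
  have hpow := sum_lintegral_le_of_power hn hxm hP
  -- The coefficient of the linear estimate of `y_b` from `y_a` when the relay has power `P`: the
  -- residual `y_b - t y_a` is then uncorrelated with `y_a`, so a product law is the right
  -- comparison.
  let t : ℝ := h a * h b * P / (1 + h a ^ 2 * P)
  let g : Node → ℝ := Function.update (Function.update 0 (some a) (h a)) (some b) (h b - t * h a)
  let d : Messages n R → Noise n → Fin n → Node → ℝ := fun m z i v => g v * x m z i
  have hd : ∀ m, IsPredictable (d m) := fun m i z z' hz => by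
    funext v; simp only [d, hx m i z z' hz]
  have hdm : ∀ m, Measurable (d m) := fun m => measurable_pi_lambda _ fun i =>
    measurable_pi_lambda _ fun v => (hxm m i).const_mul _
  -- The residual carries the noise `z_b - t z_a`, of variance `1 + t²`.
  let τ : Node → ℝ≥0 := Function.update 1 (some b) (1 + (t ^ 2).toNNReal)
  let s : Node → ℝ≥0 := fun v => τ v + (g v ^ 2).toNNReal * P
  have hτ : ∀ v, 0 < τ v := fun v => by
    by_cases hv : v = some b <;> simp [τ, hv]
  have hs : ∀ v, s v ≠ 0 := fun v => (add_pos_of_pos_of_nonneg (hτ v) zero_le).ne'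
  have key := log_mul_sum_measure_le (n := n) hs
    (Ψ := fun m => shear (mix (some a) (some b) t) (d m))
    (fun m => (hd m).measurePreserving_shear (hdm m) (measurePreserving_mix hab' t))
    (fun m => (hd m).injective_shear (injective_mix hab' t))
    (A := fun m => e.correct h m) (fun m => e.measurableSet_correct h m)
    (fun m => (m a, m b ⟨c, hbc.symm⟩)) ?_ hN hcard ?_
  · have hsum : ∑ v, Real.log (s v) / 2 = Real.log (1 + (h a ^ 2 + h b ^ 2) * P) / 2 := by
      have h1 : (0 : ℝ) < 1 + h a ^ 2 * P := by positivity
      have hsn : s none = 1 := by simp [s, g, τ]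
      have hsa : (s (some a) : ℝ) = 1 + h a ^ 2 * P := by
        simp [s, g, τ, hab, Real.coe_toNNReal _ (sq_nonneg _)]
      have hsb : (s (some b) : ℝ) = 1 + t ^ 2 + (h b - t * h a) ^ 2 * P := by
        simp [s, g, τ, Real.coe_toNNReal _ (sq_nonneg _)]
      have hsc : s (some c) = 1 := by simp [s, g, τ, hac.symm, hbc.symm]
      -- The product of the decorrelated variances is the determinant of the covariance matrix of
      -- `(y_a, y_b)`.
      have hprod : (1 + h a ^ 2 * P) * (1 + t ^ 2 + (h b - t * h a) ^ 2 * P) =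
          1 + (h a ^ 2 + h b ^ 2) * P := by
        simp only [t]
        field_simp
        ring
      rw [Fintype.sum_option, sum_user hab hac hbc, hsn, hsc, hsa, hsb, ← hprod,
        Real.log_mul h1.ne' (by positivity)]
      simp
      ring
    rw [e.sum_measure_correct, hsum, mul_left_comm] at key
    exact le_of_mul_le_mul_left key hMpos
  · intro m m' z z' hκ hz hz' hΨ
    have hma : m a = m' a := congrArg Prod.fst hκ
    have hra : ∀ i, e.received h m z i (some a) = e.received h m' z' i (some a) := fun i => by
      have := congrFun (congrFun hΨ i) (some a)
      simp only [shear, mix, d, g, x, Pi.add_apply, ne_eq, hab', not_false_eq_true,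
        Function.update_of_ne, Function.update_self] at this
      rw [received_user, received_user]
      linarith
    have hrb : ∀ i, e.received h m z i (some b) = e.received h m' z' i (some b) := fun i => by
      have h1 := congrFun (congrFun hΨ i) (some b)
      have h2 := hra i
      simp only [shear, mix, d, g, x, Pi.add_apply, Function.update_self] at h1
      rw [received_user, received_user] at h2 ⊢
      linear_combination h1 + t * h2
    exact e.messages_eq_of_received_eq h hab hac hbc hma (congrArg Prod.snd hκ) hra hrb hz hz'
  · intro v
    have hmix : Measurable fun w : Node → ℝ => mix (some a) (some b) t w v :=
      (measurable_pi_apply v).comp (measurePreserving_mix hab' t).measurable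
    have hW : ∀ i : Fin n, ∫⁻ z, ENNReal.ofReal (mix (some a) (some b) t (z i) v ^ 2)
        ∂gaussianNoise n (fun _ => 1) ≤ τ v := fun i => by
      by_cases hv : v = some b
      · subst hv
        simp only [mix, Function.update_self, τ, sub_eq_add_neg]
        -- Flipping only the noise of `b` separates it from that of `a`.
        rw [lintegral_add_sq_of_flip (measurePreserving_sign_gaussianNoise (fun _ => 1)
          fun _ v => if v = some b then -1 else 1) (by fun_prop) (by fun_prop)
          (fun z => by simp) (fun z => by simp [hab]), lintegral_sq_gaussianNoise]
        simp_rw [neg_sq, mul_pow, ENNReal.ofReal_mul (sq_nonneg t)]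
        rw [lintegral_const_mul _ (by fun_prop), lintegral_sq_gaussianNoise]
        simp [ENNReal.ofReal]
      · simp [mix, hv, τ, lintegral_sq_gaussianNoise]
    have := sum_lintegral_add_sq_le (n := n) hmix (fun w => ?_) hW
      (d := fun m z i => d m z i v) (fun m i z z' hz => congrFun (hd m i z z' hz) v)
      (fun m i => (hxm m i).const_mul _) (sum_lintegral_const_mul_sq_le hxm hpow (g v))
    · simpa [shear, s] using this
    · by_cases hv : v = some b
      · subst hv; simp [mix]; ring
      · simp [mix, hv]

end Bounds

/-! ### Rates -/

theorem one_le_two_rpow {n : ℕ} {r : ℝ} (hr : 0 ≤ r) : (1 : ℝ) ≤ 2 ^ ((n : ℝ) * r) :=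
  Real.one_le_rpow one_le_two (by positivity)

theorem one_le_floor_two_rpow {n : ℕ} {r : ℝ} (hr : 0 ≤ r) : 1 ≤ ⌊(2 : ℝ) ^ ((n : ℝ) * r)⌋₊ :=
  Nat.le_floor (by simpa using one_le_two_rpow hr)

theorem nonempty_messages (n : ℕ) {R : RateTuple} (hR : ∀ j k, 0 ≤ R j k) :
    Nonempty (Messages n R) :=
  ⟨fun j k => ⟨0, one_le_floor_two_rpow (hR j k)⟩⟩

/-- Rounding costs at most one bit: `y < ⌊y⌋ + 1 ≤ 2 ⌊y⌋` once `y ≥ 1`. -/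
theorem mul_log_two_le_log_floor {n : ℕ} {r : ℝ} (hr : 0 ≤ r) :
    (n * r - 1) * Real.log 2 ≤ Real.log ⌊(2 : ℝ) ^ ((n : ℝ) * r)⌋₊ := by
  have h1 : (1 : ℝ) ≤ ⌊(2 : ℝ) ^ ((n : ℝ) * r)⌋₊ := by exact_mod_cast one_le_floor_two_rpow hr
  have h2 := Nat.lt_floor_add_one ((2 : ℝ) ^ ((n : ℝ) * r))
  rw [← Real.log_rpow two_pos, Real.rpow_sub two_pos, Real.rpow_one]
  exact Real.log_le_log (by positivity) (by linarith)

theorem prod_user {M : Type*} [CommMonoid M] {a b c : User} (hab : a ≠ b) (hac : a ≠ c)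
    (hbc : b ≠ c) (f : User → M) : ∏ j, f j = f a * f b * f c :=
  sum_user (M := Additive M) hab hac hbc f

theorem prod_others {M : Type*} [CommMonoid M] {a b c : User} (hab : a ≠ b) (hac : a ≠ c)
    (hbc : b ≠ c) (f : Others a → M) : ∏ k, f k = f ⟨b, hab.symm⟩ * f ⟨c, hac.symm⟩ := by
  refine Fintype.prod_eq_mul _ _ (by simpa using hbc) fun ⟨k, hk⟩ h => ?_
  rcases user_eq_of_ne hab hac hbc k with rfl | rfl | rfl <;> simp at hk h

theorem sum_others {M : Type*} [AddCommMonoid M] {a b c : User} (hab : a ≠ b) (hac : a ≠ c)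
    (hbc : b ≠ c) (f : Others a → M) : ∑ k, f k = f ⟨b, hab.symm⟩ + f ⟨c, hac.symm⟩ :=
  prod_others (M := Multiplicative M) hab hac hbc f

/-- The first three factors count the messages to be resolved; taking their product as `N` makes the
cardinality condition of the converse an equality. -/
theorem card_messages_eq (n : ℕ) (R : RateTuple) {a b c : User} (hab : a ≠ b) (hac : a ≠ c)
    (hbc : b ≠ c) :
    Fintype.card (Messages n R) =
      ⌊(2 : ℝ) ^ ((n : ℝ) * R b ⟨a, hab⟩)⌋₊ * ⌊(2 : ℝ) ^ ((n : ℝ) * R c ⟨a, hac⟩)⌋₊ *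
        ⌊(2 : ℝ) ^ ((n : ℝ) * R c ⟨b, hbc⟩)⌋₊ *
      Fintype.card (OwnMessages n R a × MessageSet n (R b ⟨c, hbc.symm⟩)) := by
  rw [Fintype.card_pi, prod_user hab hac hbc, Fintype.card_prod,
    Fintype.card_pi (α := fun k : Others b => MessageSet n (R b k)),
    Fintype.card_pi (α := fun k : Others c => MessageSet n (R c k)),
    prod_others hab.symm hbc hac, prod_others hac.symm hbc.symm hab]
  simp only [Fintype.card_fin]
  ring

/-- A bound on a sum of three rates from a bound on the number of messages in each code. -/
theorem IsAchievable.add_add_le {h : User → ℝ} {P Pr : ℝ} {R : RateTuple}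
    (hR : IsAchievable h P Pr R) {a b c : User} (hab : a ≠ b) (hac : a ≠ c) (hbc : b ≠ c) {B : ℝ}
    (hB : ∀ (n : ℕ) (e : Code n R), n ≠ 0 → Nonempty (Messages n R) → e.MeetsPower h P Pr →
      ∀ N : ℝ, 0 < N →
        N * Fintype.card (OwnMessages n R a × MessageSet n (R b ⟨c, hbc.symm⟩)) ≤
          Fintype.card (Messages n R) →
        Real.log N * (1 - (e.errorProb h).toReal) ≤ Real.log 2 + n * B) :
    R b ⟨a, hab⟩ + R c ⟨a, hac⟩ + R c ⟨b, hbc⟩ ≤ B / Real.log 2 := by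
  obtain ⟨hR0, e, hpow, herr⟩ := hR
  have hlog2 : 0 < Real.log 2 := Real.log_pos one_lt_two
  set r := R b ⟨a, hab⟩ + R c ⟨a, hac⟩ + R c ⟨b, hbc⟩ with hr
  have herr' : Tendsto (fun n => ((e n).errorProb h).toReal) atTop (𝓝 0) := by
    simpa [Function.comp_def] using (ENNReal.tendsto_toReal ENNReal.zero_ne_top).comp herr
  have hinv : Tendsto (fun n : ℕ => (n : ℝ)⁻¹) atTop (𝓝 0) := tendsto_inv_atTop_nhds_zero_nat
  -- The `3` is one lost bit for each of the three floors.
  have hL : Tendsto (fun n : ℕ => (r - 3 * (n : ℝ)⁻¹) * Real.log 2 *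
      (1 - ((e n).errorProb h).toReal)) atTop (𝓝 (r * Real.log 2)) := by
    simpa using (((tendsto_const_nhds (x := r)).sub (hinv.const_mul 3)).mul_const
      (Real.log 2)).mul ((tendsto_const_nhds (x := (1 : ℝ))).sub herr')
  have hU : Tendsto (fun n : ℕ => (n : ℝ)⁻¹ * Real.log 2 + B) atTop (𝓝 B) := by
    simpa using (hinv.mul_const (Real.log 2)).add_const B
  rw [le_div_iff₀ hlog2]
  refine le_of_tendsto_of_tendsto hL hU ?_
  filter_upwards [eventually_ne_atTop 0, herr'.eventually_le_const one_pos] with n hn hε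
  have hn' : (0 : ℝ) < n := by positivity
  have hpos : ∀ j k, (0 : ℝ) < ⌊(2 : ℝ) ^ ((n : ℝ) * R j k)⌋₊ := fun j k => by
    exact_mod_cast one_le_floor_two_rpow (hR0 j k)
  have h1 := hB n (e n) hn (nonempty_messages n hR0) (hpow n)
    (⌊(2 : ℝ) ^ ((n : ℝ) * R b ⟨a, hab⟩)⌋₊ * ⌊(2 : ℝ) ^ ((n : ℝ) * R c ⟨a, hac⟩)⌋₊ *
      ⌊(2 : ℝ) ^ ((n : ℝ) * R c ⟨b, hbc⟩)⌋₊)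
    (mul_pos (mul_pos (hpos _ _) (hpos _ _)) (hpos _ _))
    (by rw [card_messages_eq n R hab hac hbc]; push_cast; exact le_rfl)
  rw [Real.log_mul (mul_pos (hpos _ _) (hpos _ _)).ne' (hpos _ _).ne',
    Real.log_mul (hpos _ _).ne' (hpos _ _).ne'] at h1
  have h2 := mul_log_two_le_log_floor (n := n) (hR0 b ⟨a, hab⟩)
  have h3 := mul_log_two_le_log_floor (n := n) (hR0 c ⟨a, hac⟩)
  have h4 := mul_log_two_le_log_floor (n := n) (hR0 c ⟨b, hbc⟩)
  have h5 := (mul_le_mul_of_nonneg_right (add_le_add (add_le_add h2 h3) h4)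
    (sub_nonneg.2 hε)).trans h1
  have h6 := mul_le_mul_of_nonneg_left h5 (inv_nonneg.2 hn'.le)
  have h7 : (n : ℝ)⁻¹ * n = 1 := inv_mul_cancel₀ hn'.ne'
  rw [hr]
  linear_combination h6 + ((R b ⟨a, hab⟩ + R c ⟨a, hac⟩ + R c ⟨b, hbc⟩) * Real.log 2 *
    (((e n).errorProb h).toReal - 1) + B) * h7

theorem gaussianCap_eq (x : ℝ) : gaussianCap x = Real.log (1 + x) / 2 / Real.log 2 := by
  rw [gaussianCap, Real.logb]; ring

theorem IsAchievable.add_add_le_uplink {h : User → ℝ} {P Pr : ℝ} {R : RateTuple} (hP : 0 ≤ P)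
    (hR : IsAchievable h P Pr R) {a b c : User} (hab : a ≠ b) (hac : a ≠ c) (hbc : b ≠ c) :
    R b ⟨a, hab⟩ + R c ⟨a, hac⟩ + R c ⟨b, hbc⟩ ≤ gaussianCap ((|h b| + |h c|) ^ 2 * P) := by
  rw [gaussianCap_eq]
  lift P to ℝ≥0 using hP
  refine hR.add_add_le hab hac hbc fun n e hn _ hpow N hN hcard => ?_
  exact e.log_mul_le_uplink hn h (by simpa using hpow.1) hab hac hbc hN hcard

theorem IsAchievable.add_add_le_downlink {h : User → ℝ} {P Pr : ℝ} {R : RateTuple} (hP : 0 ≤ Pr)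
    (hR : IsAchievable h P Pr R) {a b c : User} (hab : a ≠ b) (hac : a ≠ c) (hbc : b ≠ c) :
    R b ⟨a, hab⟩ + R c ⟨a, hac⟩ + R c ⟨b, hbc⟩ ≤ gaussianCap (h a ^ 2 * Pr + h b ^ 2 * Pr) := by
  rw [gaussianCap_eq, ← add_mul]
  lift Pr to ℝ≥0 using hP
  refine hR.add_add_le hab hac hbc fun n e hn _ hpow N hN hcard => ?_
  exact e.log_mul_le_downlink hn h (by simpa using hpow.2) hab hac hbc hN hcard

/-- The triples for `(a, b, c) = (2, 3, 1)` and `(1, 3, 2)`, in the numbering 1, 2, 3 of the users,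
partition the six rates. The second obeys both a downlink and an uplink bound, which accounts for
the minimum. -/
theorem IsAchievable.sumRate_le {h₁ h₂ h₃ P : ℝ} {R : RateTuple} (hP : 0 ≤ P)
    (hR : IsAchievable ![h₁, h₂, h₃] P P R) : sumRate R ≤ sumBound h₁ h₂ h₃ P := by
  have h01 : (0 : User) ≠ 1 := by decide
  have h02 : (0 : User) ≠ 2 := by decide
  have h12 : (1 : User) ≠ 2 := by decide
  have hA := hR.add_add_le_downlink hP h12 h01.symm h02.symm
  have hB := hR.add_add_le_downlink hP h02 h01 h12.symm
  have hC := hR.add_add_le_uplink hP h02 h01 h12.symm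
  have hsum : sumRate R = (R 2 ⟨1, h12⟩ + R 0 ⟨1, h01.symm⟩ + R 0 ⟨2, h02.symm⟩) +
      (R 2 ⟨0, h02⟩ + R 1 ⟨0, h01⟩ + R 1 ⟨2, h12.symm⟩) := by
    rw [sumRate, sum_user h01 h02 h12, sum_others h01 h02 h12, sum_others h01.symm h12 h02,
      sum_others h02.symm h12.symm h01]
    ring
  simp only [Matrix.cons_val_zero, Matrix.cons_val_one, Matrix.cons_val] at hA hB hC
  rw [hsum, sumBound]
  refine add_le_add hA ?_
  rw [add_comm |h₂|]
  rcases min_choice (h₁ ^ 2 * P + h₃ ^ 2 * P) ((|h₃| + |h₂|) ^ 2 * P) with h | h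
  · rw [h]; exact hB
  · rw [h]; exact hC

/-! ### The pre-log -/

/-- Factor `1 + x P = P (P⁻¹ + x)`. -/
theorem tendsto_gaussianCap_sub {x : ℝ} (hx : 0 < x) :
    Tendsto (fun P : ℝ => gaussianCap (x * P) - 1 / 2 * Real.logb 2 P) atTop
      (𝓝 (1 / 2 * Real.logb 2 x)) := by
  have h : Tendsto (fun P : ℝ => 1 / 2 * Real.logb 2 (P⁻¹ + x)) atTop
      (𝓝 (1 / 2 * Real.logb 2 x)) := by
    have h1 : Tendsto (fun P : ℝ => P⁻¹ + x) atTop (𝓝 x) := by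
      simpa using tendsto_inv_atTop_zero.add_const x
    exact ((h1.log hx.ne').div_const _).const_mul _
  refine h.congr' ?_
  filter_upwards [eventually_gt_atTop 0] with P hP
  rw [gaussianCap, ← mul_sub, ← Real.logb_div (by positivity) hP.ne']
  congr 2
  field_simp

theorem isLittleO_sumBound_sub {h₁ h₂ h₃ : ℝ} (h_ord : h₂ ^ 2 ≤ h₁ ^ 2) (h_ne : h₂ ≠ 0) :
    (fun P : ℝ => sumBound h₁ h₂ h₃ P - Real.logb 2 P) =o[atTop] fun P : ℝ => Real.logb 2 P := by
  have h2 : 0 < h₂ ^ 2 := by positivity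
  have hx : 0 < h₂ ^ 2 + h₃ ^ 2 := by positivity
  -- The ordering forces `h₁ ≠ 0`, so both `C` terms grow like `½ log P` and their sum differs from
  -- `log P` by a bounded amount.
  have hy : 0 < min (h₁ ^ 2 + h₃ ^ 2) ((|h₂| + |h₃|) ^ 2) :=
    lt_min (by nlinarith [sq_nonneg h₃]) (by positivity)
  have hlim := (tendsto_gaussianCap_sub hx).add (tendsto_gaussianCap_sub hy)
  have hbig : (fun P : ℝ => sumBound h₁ h₂ h₃ P - Real.logb 2 P) =O[atTop] fun _ => (1 : ℝ) := by
    refine (hlim.isBigO_one ℝ).congr' ?_ EventuallyEq.rfl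
    filter_upwards [eventually_ge_atTop 0] with P hP
    rw [sumBound, ← add_mul, ← add_mul, ← min_mul_of_nonneg _ _ hP]
    ring
  exact hbig.trans_isLittleO
    ((Asymptotics.isLittleO_one_left_iff ℝ).2
      (tendsto_norm_atTop_atTop.comp (Real.tendsto_logb_atTop one_lt_two)))

end YChannel

theorem mainTheorem4 (h₁ h₂ h₃ : ℝ) (h_ord₁₂ : h₂ ^ 2 ≤ h₁ ^ 2) (h_ord₂₃ : h₃ ^ 2 ≤ h₂ ^ 2) :
    (∀ P : ℝ, 0 ≤ P →
      YChannel.sumCapacity ![h₁, h₂, h₃] P P ≤ (YChannel.sumBound h₁ h₂ h₃ P : EReal)) ∧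
    (h₂ ≠ 0 →
      Asymptotics.IsLittleO Filter.atTop
        (fun P : ℝ => YChannel.sumBound h₁ h₂ h₃ P - Real.logb 2 P)
        (fun P : ℝ => Real.logb 2 P)) :=
  ⟨fun _ hP => iSup₂_le fun _ hR => EReal.coe_le_coe_iff.2 (YChannel.IsAchievable.sumRate_le hP hR),
    fun h_ne => YChannel.isLittleO_sumBound_sub h_ord₁₂ h_ne⟩
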